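/- **Notation.** For $p\in\mathbb C$ with $|p|<1$ and $x\in\mathbb C\setminus\{0\}$ let $$\theta(x;p)=\prod_{j\ge0}(1-p^jx)(1-p^{j+1}/x),\qquad \theta(x_1,\dots,x_t;p)=\prod_{k=1}^t\theta(x_k;p)$$ (so $\theta(x;0)=1-x$), and for $q\in\mathbb C\setminus\{0\}$ and $n\in\mathbb Z$ let $$(x;q,p)_n=\begin{cases}\prod_{k=0}^{n-1}\theta(xq^k;p),& n\ge 0,\\[2pt] 1/\prod_{k=0}^{-n-1}\theta(xq^{n+k};p),& n<0,\end{cases}\qquad (x_1,\dots,x_t;q,p)_n=\prod_{k=1}^t(x_k;q,p)_n .$$ **Corollary (multivariable elliptic Karlsson–Minton type identity).** Let $q,p\in\mathbb C$, $q\ne0$, $|p|<1$, let $m\ge 0$, and let $a_i,z_i$ ($1\le i\le m$) be nonzero complex numbers. For each $i$ let $s_i\ge0$ be an integer, and for $1\le j\le s_i$ let $b_{ij}\in\mathbb C\setminus\{0\}$ and $v_{ij}\in\mathbb Z_{\ge0}$. For $1\le i<j\le m$ let $w_{ij},r_{ij}\in\mathbb Z_{\ge0}$, and for $1\le l\le r_{ij}$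 let $\alpha_{ijl}\in\mathbb C\setminus\{0\}$ and $u_{ijl}\in\mathbb Z_{\ge0}$. For $i=1,\dots,m$ put $$n_i=\sum_{j=1}^{s_i}v_{ij}+\sum_{j=1}^{i-1}w_{ji}+\sum_{j=i+1}^m w_{ij}+2\sum_{j=1}^{i-1}\sum_{l=1}^{r_{ji}}u_{jil}+2\sum_{j=i+1}^m\sum_{l=1}^{r_{ij}}u_{ijl}.$$ Assume that no denominator in the identity below vanishes and that all theta shifted factorials of negative index in it are defined, i.e. that the following are nonzero: for all $i$, $$\theta(a_i^2;p),\qquad (q,a_i^2q^{n_i+1},a_iqz_i,a_iq/z_i;q,p)_{n_i};$$ for all $i$ and $1\le j\le s_i$, $$(b_{ij}a_i,b_{ij}/a_i;q,p)_{v_{ij}},\qquad (a_ib_{ij},a_iq^{1-v_{ij}}/b_{ij};q,p)_{n_i};$$ and for all $i<j$ and $1\le l\le r_{ij}$, writing $\alpha=\alpha_{ijl}$ and $u=u_{ijl}$, $$(\alpha a_ia_j,\alpha a_i/a_j,\alpha a_j/a_i,\alpha/a_ia_j;q,p)_{u},\qquad (\alpha a_ia_j,q^{1-u}a_ia_j/\alpha;q,p)_{n_i+n_j},\qquad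 (\alpha a_i/a_j,q^{1-u}a_i/a_j\alpha;q,p)_{n_i},$$ as well as $\theta(xq^{-h};p)$ for $1\le h\le n_j$ and $x\in\{\alpha a_i/a_j,\ q^{1-u}a_i/a_j\alpha,\ \alpha a_iq^{u}/a_j,\ qa_i/a_j\alpha\}$. Then $$\begin{aligned} &\prod_{i=1}^m\left(\frac{(a_i^2q,q;q,p)_{n_i}}{(a_iqz_i,a_iq/z_i;q,p)_{n_i}}\prod_{j=1}^{s_i}\frac{(b_{ij}z_i,b_{ij}/z_i;q,p)_{v_{ij}}}{(b_{ij}a_i,b_{ij}/a_i;q,p)_{v_{ij}}}\right)\\ &\times\prod_{1\le i<j\le m}\left(a_i^{w_{ij}}z_i^{-w_{ij}}\theta(z_iz_j,z_i/z_j;p)^{w_{ij}}\prod_{l=1}^{r_{ij}}\frac{(\alpha_{ijl}z_iz_j,\alpha_{ijl}z_i/z_j,\alpha_{ijl}z_j/z_i,\alpha_{ijl}/z_iz_j;q,p)_{u_{ijl}}}{(\alpha_{ijl}a_ia_j,\alpha_{ijl}a_i/a_j,\alpha_{ijl}a_j/a_i,\alpha_{ijl}/a_ia_j;q,p)_{u_{ijl}}}\right)\\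 &=\sum_{k_1=0}^{n_1}\cdots\sum_{k_m=0}^{n_m}\ \prod_{i=1}^m\left(q^{k_i}\frac{\theta(a_i^2q^{2k_i};p)}{\theta(a_i^2;p)}\frac{(q^{-n_i},a_i^2,a_iz_i,a_i/z_i;q,p)_{k_i}}{(q,a_i^2q^{n_i+1},a_iqz_i,a_iq/z_i;q,p)_{k_i}}\prod_{j=1}^{s_i}\frac{(a_ib_{ij}q^{v_{ij}},a_iq/b_{ij};q,p)_{k_i}}{(a_ib_{ij},a_iq^{1-v_{ij}}/b_{ij};q,p)_{k_i}}\right)\\ &\quad\times\prod_{1\le i<j\le m}\prod_{l=1}^{r_{ij}}q^{2u_{ijl}k_j}\frac{(\alpha_{ijl}a_ia_jq^{u_{ijl}},qa_ia_j/\alpha_{ijl};q,p)_{k_i+k_j}\,(\alpha_{ijl}a_iq^{u_{ijl}}/a_j,qa_i/a_j\alpha_{ijl};q,p)_{k_i-k_j}}{(\alpha_{ijl}a_ia_j,q^{1-u_{ijl}}a_ia_j/\alpha_{ijl};q,p)_{k_i+k_j}\,(\alpha_{ijl}a_i/a_j,q^{1-u_{ijl}}a_i/a_j\alpha_{ijl};q,p)_{k_i-k_j}}\\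 &\quad\times\prod_{1\le i<j\le m}q^{w_{ij}k_j}\,\theta(a_ia_jq^{k_i+k_j},a_iq^{k_i-k_j}/a_j;p)^{w_{ij}} . \end{aligned}$$ -/

import Mathlib

open scoped BigOperators

namespace EllipticKM

noncomputable section

/-- The modified Jacobi theta function
`θ(x; p) = ∏_{j ≥ 0} (1 - p ^ j x) (1 - p ^ (j + 1) / x)`, for `x ≠ 0` and `‖p‖ < 1`
(for `p = 0` it is `1 - x`). -/
def theta (x p : ℂ) : ℂ :=
  ∏' j : ℕ, ((1 - p ^ j * x) * (1 - p ^ (j + 1) / x))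

/-- `θ(x₁, …, x_m; p) = θ(x₁; p) ⋯ θ(x_m; p)`. -/
def thetas (xs : List ℂ) (p : ℂ) : ℂ :=
  (xs.map fun x => theta x p).prod

/-- The theta shifted factorial `(a; q, p)_n` for an integer `n`. It equals
`∏_{k=0}^{n-1} θ(a q ^ k; p)` for `n ≥ 0` and
`1 / ∏_{k=0}^{-n-1} θ(a q ^ (n + k); p)` for `n < 0`. -/
def thetaFac (a q p : ℂ) : ℤ → ℂ
  | Int.ofNat n => ∏ k ∈ Finset.range n, theta (a * q ^ k) p
  | Int.negSucc n =>
      1 / ∏ k ∈ Finset.range (n + 1), theta (a * q ^ (Int.negSucc n + (k : ℤ))) p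

/-- `(a₁, …, a_m; q, p)_n = (a₁; q, p)_n ⋯ (a_m; q, p)_n`. -/
def thetaFacs (as : List ℂ) (q p : ℂ) (n : ℤ) : ℂ :=
  (as.map fun a => thetaFac a q p n).prod

end

end EllipticKM

namespace EllipticKM

open Filter Topology

/-! The identity is Lagrange interpolation for theta functions, carried out in each variable
separately. Call `f` a theta polynomial of degree `n` if it is a constant times a product of `n`
functions `θ(bz, b/z; p)`. Such an `f` is determined by its values at `n + 1` generic nodes, because
`θ(xy, x/y; p)` is, up to the factor `x`, a determinant `X(x)Y(y) - Y(x)X(y)`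
(`exists_theta_mul_theta`, from the Jacobi triple product `phi_mul_theta`). The Plücker relation for
such determinants yields the interpolation formula `prod_alternating_eq_sum`. At the nodes `a q^k`
the Lagrange coefficients become the very-well-poised factors `kernel`
(`IsThetaPoly.mul_eq_sum_kernel`). The numerators in `z` on the left side form a function `F(z_1, …,
z_m)` that is a theta polynomial in every variable, of degree exactly `n_i` in `z_i`
(`isThetaPoly_update`). Interpolating in all variables (`prod_mul_eq_sum_piFinset`) gives the
multiple sum. Its summands contain values of `F` at `(a_i q^{k_i})`, and `thetaFacs_pair_shift` and
`pairFactor_shift` rewrite these, divided by the denominators in the `a_i`, as shifted factorials of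
index `k_i` and `k_i ± k_j`. -/

/-! ### The theta function as an infinite product. -/

/-- The infinite product `(x; p)_∞ = ∏_{j ≥ 0} (1 - p ^ j x)`. -/
noncomputable def phi (p x : ℂ) : ℂ := ∏' j : ℕ, (1 - p ^ j * x)

lemma summable_norm_pow_mul {p : ℂ} (hp : ‖p‖ < 1) (x : ℂ) :
    Summable fun j : ℕ => ‖-(p ^ j * x)‖ := by
  simp only [norm_neg, norm_mul, norm_pow]
  exact (summable_geometric_of_lt_one (norm_nonneg p) hp).mul_right _

lemma multipliable_phi {p : ℂ} (hp : ‖p‖ < 1) (x : ℂ) :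
    Multipliable fun j : ℕ => (1 - p ^ j * x) := by
  simpa only [sub_eq_add_neg] using multipliable_one_add_of_summable (summable_norm_pow_mul hp x)

lemma phi_eq_one_sub_mul {p : ℂ} (hp : ‖p‖ < 1) (x : ℂ) :
    phi p x = (1 - x) * phi p (p * x) := by
  have h := multipliable_phi hp (p * x)
  have e : ∀ j : ℕ, 1 - p ^ j * (p * x) = 1 - p ^ (j + 1) * x := fun j => by ring
  unfold phi
  rw [tprod_eq_zero_mul' (by simpa only [e] using h)]
  simp [e]

lemma tendsto_phi {p : ℂ} (hp : ‖p‖ < 1) (x : ℂ) :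
    Tendsto (fun N => ∏ j ∈ Finset.range N, (1 - p ^ j * x)) atTop (𝓝 (phi p x)) :=
  (multipliable_phi hp x).hasProd.tendsto_prod_nat

lemma exists_of_phi_eq_zero {p : ℂ} (hp : ‖p‖ < 1) {x : ℂ} (h : phi p x = 0) :
    ∃ j : ℕ, p ^ j * x = 1 := by
  by_contra! hne
  refine tprod_one_add_ne_zero_of_summable (f := fun j : ℕ => -(p ^ j * x)) (fun j => ?_)
    (summable_norm_pow_mul hp x) (by simpa only [phi, sub_eq_add_neg] using h)
  rw [← sub_eq_add_neg]
  exact sub_ne_zero.2 (hne j).symm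

lemma continuous_phi {p : ℂ} (hp : ‖p‖ < 1) : Continuous (phi p) := by
  rw [continuous_iff_continuousAt]
  intro x
  have hS : Summable fun j : ℕ => ‖p‖ ^ j * (‖x‖ + 1) :=
    (summable_geometric_of_lt_one (norm_nonneg p) hp).mul_right _
  have h := hS.hasProdUniformlyOn_one_add (K := Metric.closedBall x 1)
    (f := fun (j : ℕ) (y : ℂ) => -(p ^ j * y)) (isCompact_closedBall x 1)
    (Eventually.of_forall fun j y hy => by
      rw [norm_neg, norm_mul, norm_pow]
      gcongr
      have := norm_sub_norm_le y x
      rw [Metric.mem_closedBall, dist_eq_norm] at hy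
      linarith)
    (fun j => by fun_prop)
  have hc : ContinuousOn (phi p) (Metric.closedBall x 1) := by
    have := h.tendstoUniformlyOn.continuousOn (Frequently.of_forall fun s => by fun_prop)
    have e : phi p = fun y => ∏' j : ℕ, (1 + -(p ^ j * y)) := by
      funext y; simp only [phi, sub_eq_add_neg]
    rwa [e]
  exact hc.continuousAt (Metric.closedBall_mem_nhds x one_pos)

lemma theta_eq_phi_mul_phi {p : ℂ} (hp : ‖p‖ < 1) (x : ℂ) :
    theta x p = phi p x * phi p (p / x) := by
  unfold theta phi
  rw [← (multipliable_phi hp x).tprod_mul (multipliable_phi hp (p / x))]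
  refine tprod_congr fun j => ?_
  ring

lemma theta_inv {p : ℂ} (hp : ‖p‖ < 1) {x : ℂ} (hx : x ≠ 0) :
    theta x⁻¹ p = -x⁻¹ * theta x p := by
  rw [theta_eq_phi_mul_phi hp, theta_eq_phi_mul_phi hp, phi_eq_one_sub_mul hp x,
    phi_eq_one_sub_mul hp x⁻¹]
  have : p / x⁻¹ = p * x := by simp
  rw [this, ← div_eq_mul_inv]
  field_simp
  ring

lemma continuousAt_theta {p : ℂ} (hp : ‖p‖ < 1) {x : ℂ} (hx : x ≠ 0) :
    ContinuousAt (fun y => theta y p) x := by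
  simp only [theta_eq_phi_mul_phi hp]
  exact (continuous_phi hp).continuousAt.mul
    ((continuous_phi hp).continuousAt.comp (continuousAt_const.div continuousAt_id hx))

/-- Countability suffices later: the parameters at which interpolation nodes collide then have dense
complement. -/
lemma countable_zeros_theta {p : ℂ} (hp : ‖p‖ < 1) : {x : ℂ | theta x p = 0}.Countable := by
  refine ((Set.countable_range fun j : ℕ => (p ^ j)⁻¹).union
    (Set.countable_range fun j : ℕ => p ^ j * p)).mono ?_
  intro x hx
  rw [Set.mem_ofPred_eq, theta_eq_phi_mul_phi hp, mul_eq_zero] at hx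
  rcases hx with h | h <;> obtain ⟨j, hj⟩ := exists_of_phi_eq_zero hp h
  · exact Or.inl ⟨j, inv_eq_of_mul_eq_one_right hj⟩
  · refine Or.inr ⟨j, ?_⟩
    have hx : x ≠ 0 := by rintro rfl; simp at hj
    field_simp at hj
    simpa using hj

/-! ### Gaussian binomials and the finite `q`-binomial theorem. -/

/-- The Gaussian binomial coefficients, by the `q`-Pascal recursion. -/
noncomputable def gaussBinom (p : ℂ) : ℕ → ℕ → ℂ
  | _, 0 => 1
  | 0, _ + 1 => 0
  | n + 1, k + 1 => p ^ (k + 1) * gaussBinom p n (k + 1) + gaussBinom p n k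

lemma gaussBinom_eq_zero (p : ℂ) : ∀ {n k : ℕ}, n < k → gaussBinom p n k = 0
  | _, 0, h => by omega
  | 0, k + 1, _ => by simp [gaussBinom]
  | n + 1, k + 1, h => by
    rw [gaussBinom, gaussBinom_eq_zero p (by omega), gaussBinom_eq_zero p (by omega)]; simp

lemma gaussBinom_self (p : ℂ) : ∀ n : ℕ, gaussBinom p n n = 1
  | 0 => by simp [gaussBinom]
  | n + 1 => by rw [gaussBinom, gaussBinom_eq_zero p (by omega), gaussBinom_self p n]; simp

/-- `(p; p)_n`. -/
noncomputable def pFac (p : ℂ) (n : ℕ) : ℂ := ∏ j ∈ Finset.range n, (1 - p ^ j * p)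

/-- The factorial formula without division follows from the Pascal recursion for every `p`; dividing
requires `‖p‖ < 1`. -/
lemma gaussBinom_mul_pFac (p : ℂ) : ∀ a b : ℕ,
    gaussBinom p (a + b) a * (pFac p a * pFac p b) = pFac p (a + b)
  | 0, b => by simp [gaussBinom, pFac]
  | a + 1, 0 => by rw [add_zero, gaussBinom_self]; simp [pFac]
  | a + 1, b + 1 => by
    have h1 := gaussBinom_mul_pFac p (a + 1) b
    have h2 := gaussBinom_mul_pFac p a (b + 1)
    have e1 : ∀ n, pFac p (n + 1) = pFac p n * (1 - p ^ n * p) := fun n => by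
      rw [pFac, Finset.prod_range_succ, pFac]
    rw [show a + 1 + (b + 1) = (a + b + 1) + 1 by ring, gaussBinom, e1 (a + b + 1)]
    rw [show a + 1 + b = a + b + 1 by ring] at h1
    rw [show a + (b + 1) = a + b + 1 by ring] at h2
    have : (p ^ (a + 1) * gaussBinom p (a + b + 1) (a + 1) + gaussBinom p (a + b + 1) a)
        * (pFac p (a + 1) * pFac p (b + 1))
        = p ^ (a + 1) * (1 - p ^ b * p) *
            (gaussBinom p (a + b + 1) (a + 1) * (pFac p (a + 1) * pFac p b))
          + (1 - p ^ a * p) * (gaussBinom p (a + b + 1) a * (pFac p a * pFac p (b + 1))) := by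
      rw [e1 a, e1 b]; ring
    rw [this, h1, h2]
    ring
  termination_by a b => a + b

lemma one_sub_pow_mul_ne_zero {p : ℂ} (hp : ‖p‖ < 1) (j : ℕ) : 1 - p ^ j * p ≠ 0 := by
  intro h
  have h1 : p ^ (j + 1) = 1 := by rw [pow_succ]; exact (sub_eq_zero.1 h).symm
  have h2 : ‖p‖ ^ (j + 1) = 1 := by rw [← norm_pow, h1, norm_one]
  exact (pow_lt_one₀ (norm_nonneg p) hp (Nat.succ_ne_zero j)).ne h2

lemma pFac_ne_zero {p : ℂ} (hp : ‖p‖ < 1) (n : ℕ) : pFac p n ≠ 0 :=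
  Finset.prod_ne_zero_iff.2 fun j _ => one_sub_pow_mul_ne_zero hp j

lemma phi_self_ne_zero {p : ℂ} (hp : ‖p‖ < 1) : phi p p ≠ 0 := fun h => by
  obtain ⟨j, hj⟩ := exists_of_phi_eq_zero hp h
  exact one_sub_pow_mul_ne_zero hp j (sub_eq_zero.2 hj.symm)

lemma gaussBinom_eq_div {p : ℂ} (hp : ‖p‖ < 1) (a b : ℕ) :
    gaussBinom p (a + b) a = pFac p (a + b) * (pFac p a)⁻¹ * (pFac p b)⁻¹ := by
  rw [← gaussBinom_mul_pFac]
  have := pFac_ne_zero hp a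
  have := pFac_ne_zero hp b
  field_simp

/-- `(p; p)_n` converges to a nonzero limit, so it and its inverse are bounded. The bound is the
dominating constant in the limit that gives the triple product. -/
lemma exists_gaussBinom_bound {p : ℂ} (hp : ‖p‖ < 1) :
    ∃ B : ℝ, 0 ≤ B ∧ ∀ a b : ℕ, ‖gaussBinom p (a + b) a‖ ≤ B := by
  have h := tendsto_phi hp p
  obtain ⟨A, hA⟩ := (Metric.isBounded_range_of_tendsto _ h).exists_norm_le
  obtain ⟨C, hC⟩ :=
    (Metric.isBounded_range_of_tendsto _ (h.inv₀ (phi_self_ne_zero hp))).exists_norm_le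
  have hA' : ∀ n, ‖pFac p n‖ ≤ A := fun n => hA _ ⟨n, rfl⟩
  have hC' : ∀ n, ‖(pFac p n)⁻¹‖ ≤ C := fun n => hC _ ⟨n, rfl⟩
  have hA0 : 0 ≤ A := (norm_nonneg _).trans (hA' 0)
  have hC0 : 0 ≤ C := (norm_nonneg _).trans (hC' 0)
  refine ⟨A * C * C, by positivity, fun a b => ?_⟩
  rw [gaussBinom_eq_div hp, norm_mul, norm_mul]
  gcongr
  exacts [hA' _, hC' _, hC' _]

/-- The `q`-binomial theorem. -/
lemma prod_one_sub_pow_mul (p : ℂ) : ∀ (M : ℕ) (y : ℂ),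
    ∏ j ∈ Finset.range M, (1 - p ^ j * y)
      = ∑ k ∈ Finset.range (M + 1), gaussBinom p M k * ((-1) ^ k * p ^ (k.choose 2) * y ^ k)
  | 0, y => by simp [gaussBinom]
  | M + 1, y => by
    have h := prod_one_sub_pow_mul p M (p * y)
    have e : ∀ j : ℕ, 1 - p ^ j * (p * y) = 1 - p ^ (j + 1) * y := fun j => by ring
    simp only [e] at h
    rw [Finset.prod_range_succ', h, Finset.sum_range_succ' _ (M + 1)]
    have e2 : ∀ k : ℕ, gaussBinom p (M + 1) (k + 1) *
          ((-1) ^ (k + 1) * p ^ ((k + 1).choose 2) * y ^ (k + 1))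
        = gaussBinom p M (k + 1) *
            ((-1) ^ (k + 1) * p ^ ((k + 1).choose 2) * (p * y) ^ (k + 1))
          - y * (gaussBinom p M k * ((-1) ^ k * p ^ (k.choose 2) * (p * y) ^ k)) := fun k => by
      rw [gaussBinom, Nat.choose_succ_succ' k 1, Nat.choose_one_right, pow_add]
      ring
    simp only [e2, Finset.sum_sub_distrib, ← Finset.mul_sum]
    rw [Finset.sum_range_succ (fun k => gaussBinom p M (k + 1) *
      ((-1) ^ (k + 1) * p ^ ((k + 1).choose 2) * (p * y) ^ (k + 1))) M,
      gaussBinom_eq_zero p (Nat.lt_succ_self M)]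
    rw [Finset.sum_range_succ' (fun k => gaussBinom p M k *
      ((-1) ^ k * p ^ (k.choose 2) * (p * y) ^ k)) M]
    cases M <;> simp [gaussBinom] <;> ring

/-! ### The Jacobi triple product, with `p = r²` so that all exponents are integers. -/

/-- The general term of the bilateral theta series `∑ r ^ (n²) y ^ n`. -/
noncomputable def gaussTerm (r y : ℂ) (n : ℤ) : ℂ := r ^ (n * n) * y ^ n

lemma summable_nat_gaussTerm {s y : ℝ} (hs0 : 0 < s) (hs : s < 1) (hy : 0 < y) :
    Summable fun n : ℕ => s ^ (n * n) * y ^ n := by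
  refine summable_of_ratio_test_tendsto_lt_one (l := 0) one_pos
    (Eventually.of_forall fun n => by positivity) ?_
  have e : (fun n : ℕ => ‖s ^ ((n + 1) * (n + 1)) * y ^ (n + 1)‖ / ‖s ^ (n * n) * y ^ n‖)
      = fun n : ℕ => (s ^ n * s ^ n) * (s * y) := by
    funext n
    rw [Real.norm_of_nonneg (by positivity), Real.norm_of_nonneg (by positivity),
      show (n + 1) * (n + 1) = n * n + n + n + 1 by ring]
    simp only [pow_add, pow_one]
    field_simp
  rw [e]
  have h := tendsto_pow_atTop_nhds_zero_of_lt_one hs0.le hs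
  simpa using (h.mul h).mul_const (s * y)

lemma summable_norm_gaussTerm {r y : ℂ} (hr0 : r ≠ 0) (hr : ‖r‖ < 1) (hy : y ≠ 0) :
    Summable fun n : ℤ => ‖gaussTerm r y n‖ := by
  have h0 := norm_pos_iff.2 hr0
  refine Summable.of_nat_of_neg ?_ ?_
  · refine (summable_nat_gaussTerm h0 hr (norm_pos_iff.2 hy)).congr fun n => ?_
    simp only [gaussTerm, norm_mul, norm_zpow]
    norm_cast
  · refine (summable_nat_gaussTerm h0 hr (norm_pos_iff.2 (inv_ne_zero hy))).congr fun n => ?_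
    simp only [gaussTerm, norm_mul, norm_zpow, neg_mul_neg, norm_inv, zpow_neg, inv_pow]
    norm_cast

/-- The bilateral theta series `∑ r ^ (n²) y ^ n`. -/
noncomputable def gaussSum (r y : ℂ) : ℂ := ∑' n : ℤ, gaussTerm r y n

/-- Turning factors in `1/x` into factors in `x` merges the two halves of the truncated triple
product into `2N` consecutive factors, to which the `q`-binomial theorem applies. -/
lemma prod_one_sub_reflect {r x : ℂ} (hr0 : r ≠ 0) (hx : x ≠ 0) : ∀ N : ℕ,
    ∏ j ∈ Finset.range N, (1 - (r ^ 2) ^ j * (r ^ 2 / x))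
      = (-1 / x) ^ N * r ^ (N * N + N) *
          ∏ j ∈ Finset.range N, (1 - (r ^ 2) ^ j * (x / (r ^ 2) ^ N))
  | 0 => by simp
  | N + 1 => by
    have e : ∀ j : ℕ, 1 - (r ^ 2) ^ (j + 1) * (x / (r ^ 2) ^ (N + 1))
        = 1 - (r ^ 2) ^ j * (x / (r ^ 2) ^ N) := fun j => by
      field_simp
      ring
    rw [Finset.prod_range_succ, prod_one_sub_reflect hr0 hx N, Finset.prod_range_succ' _ N]
    simp only [e]
    have : (-1 / x) ^ (N + 1) * r ^ ((N + 1) * (N + 1) + (N + 1)) *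
        (1 - (r ^ 2) ^ 0 * (x / (r ^ 2) ^ (N + 1)))
        = (-1 / x) ^ N * r ^ (N * N + N) * (1 - (r ^ 2) ^ N * (r ^ 2 / x)) := by
      have e1 : r ^ ((N + 1) * (N + 1) + (N + 1)) = r ^ (N * N + N) * ((r ^ 2) ^ N * r ^ 2) := by
        rw [← pow_mul]; ring
      rw [e1, pow_succ (-1 / x)]
      field_simp
      ring
    rw [mul_comm (∏ j ∈ Finset.range N, _) (1 - _), ← mul_assoc, this]
    ring

lemma pow_choose_two_mul (r : ℂ) : ∀ k : ℕ, (r ^ 2) ^ (k.choose 2) * r ^ k = r ^ (k * k)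
  | 0 => by simp
  | k + 1 => by
    rw [Nat.choose_succ_succ' k 1, Nat.choose_one_right, pow_add, pow_succ r k,
      show (k + 1) * (k + 1) = k * k + (2 * k + 1) by ring, pow_add r, ← pow_choose_two_mul r k]
    rw [← pow_mul]
    ring

lemma gaussTerm_sub {r x : ℂ} (hr0 : r ≠ 0) (hx : x ≠ 0) (N k : ℕ) :
    (-1 / x) ^ N * r ^ (N * N + N) *
        ((-1) ^ k * (r ^ 2) ^ (k.choose 2) * (x / (r ^ 2) ^ N) ^ k)
      = gaussTerm r (-x / r) ((k : ℤ) - N) := by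
  have hy : -x / r ≠ 0 := div_ne_zero (neg_ne_zero.2 hx) hr0
  have e : ((k : ℤ) - N) * (k - N) = ((k * k + N * N : ℕ) : ℤ) - ((2 * N * k : ℕ) : ℤ) := by
    push_cast; ring
  rw [gaussTerm, e, zpow_sub₀ hr0, zpow_sub₀ hy]
  simp only [zpow_natCast]
  rw [pow_add r (k * k), ← pow_choose_two_mul r k, pow_add r (N * N) N, div_pow (-x), div_pow (-x),
    div_pow x, neg_pow x, neg_pow x, div_pow, ← pow_mul, ← pow_mul, ← pow_mul]
  have : ((-1 : ℂ)) ^ N * (-1) ^ N = 1 := by rw [← mul_pow]; simp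
  have h1 : (-1 : ℂ) ^ N ≠ 0 := pow_ne_zero _ (by norm_num)
  field_simp
  rw [pow_two, this, one_mul, mul_assoc]

lemma prod_mul_prod_eq_sum {r x : ℂ} (hr0 : r ≠ 0) (hx : x ≠ 0) (N : ℕ) :
    (∏ j ∈ Finset.range N, (1 - (r ^ 2) ^ j * x)) *
        ∏ j ∈ Finset.range N, (1 - (r ^ 2) ^ j * (r ^ 2 / x))
      = ∑ k ∈ Finset.range (2 * N + 1),
          gaussBinom (r ^ 2) (2 * N) k * gaussTerm r (-x / r) ((k : ℤ) - N) := by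
  have e : ∏ j ∈ Finset.range (2 * N), (1 - (r ^ 2) ^ j * (x / (r ^ 2) ^ N))
      = (∏ j ∈ Finset.range N, (1 - (r ^ 2) ^ j * (x / (r ^ 2) ^ N))) *
        ∏ j ∈ Finset.range N, (1 - (r ^ 2) ^ j * x) := by
    rw [two_mul, Finset.prod_range_add]
    congr 1
    refine Finset.prod_congr rfl fun j _ => ?_
    rw [pow_add]
    field_simp
  rw [prod_one_sub_reflect hr0 hx]
  calc _ = (-1 / x) ^ N * r ^ (N * N + N) *
        ∏ j ∈ Finset.range (2 * N), (1 - (r ^ 2) ^ j * (x / (r ^ 2) ^ N)) := by rw [e]; ring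
    _ = _ := by
      rw [prod_one_sub_pow_mul, Finset.mul_sum]
      refine Finset.sum_congr rfl fun k _ => ?_
      rw [← gaussTerm_sub hr0 hx]
      ring

/-- The terms of the finite form of the Jacobi triple product, indexed by `ℤ`. -/
noncomputable def tripleTerm (r y : ℂ) (N : ℕ) (n : ℤ) : ℂ :=
  if n.natAbs ≤ N then gaussBinom (r ^ 2) (2 * N) (n + N).toNat * gaussTerm r y n else 0

/-- Centring by `n = k - N` and extending by zero puts all truncations on the one index set `ℤ`, as
dominated convergence requires. -/
lemma tsum_tripleTerm (r y : ℂ) (N : ℕ) :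
    ∑' n : ℤ, tripleTerm r y N n = ∑ k ∈ Finset.range (2 * N + 1),
      gaussBinom (r ^ 2) (2 * N) k * gaussTerm r y ((k : ℤ) - N) := by
  rw [tsum_eq_sum (s := Finset.Icc (-N : ℤ) N)]
  · refine Finset.sum_nbij' (fun n => (n + N).toNat) (fun k => (k : ℤ) - N) ?_ ?_ ?_ ?_ ?_
    · intro n hn; simp only [Finset.mem_Icc, Finset.mem_range] at *; omega
    · intro n hn; simp only [Finset.mem_Icc, Finset.mem_range] at *; omega
    · intro n hn; simp only [Finset.mem_Icc] at *; omega
    · intro n hn; simp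
    · intro n hn
      simp only [Finset.mem_Icc] at hn
      rw [tripleTerm, if_pos (by omega)]
      congr 2
      omega
  · intro n hn
    simp only [Finset.mem_Icc] at hn
    rw [tripleTerm, if_neg (by omega)]

/-- The binomial is `(p;p)_{2N} / ((p;p)_{N+n} (p;p)_{N-n})`, and all three factorials tend to
`(p;p)_∞`. -/
lemma tendsto_tripleTerm {r : ℂ} (hr : ‖r ^ 2‖ < 1) (y : ℂ) (n : ℤ) :
    Tendsto (fun N => tripleTerm r y N n) atTop
      (𝓝 ((phi (r ^ 2) (r ^ 2))⁻¹ * gaussTerm r y n)) := by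
  have h := tendsto_phi hr (r ^ 2)
  have h0 := phi_self_ne_zero hr
  have t0 : Tendsto (fun N : ℕ => 2 * N) atTop atTop := tendsto_id.const_mul_atTop' two_pos
  have t1 : Tendsto (fun N : ℕ => (n + N).toNat) atTop atTop :=
    tendsto_atTop.2 fun b => (eventually_ge_atTop (b + n.natAbs)).mono fun N hN => by omega
  have t2 : Tendsto (fun N : ℕ => (N - n).toNat) atTop atTop :=
    tendsto_atTop.2 fun b => (eventually_ge_atTop (b + n.natAbs)).mono fun N hN => by omega
  have hlim := ((h.comp t0).mul ((h.inv₀ h0).comp t1)).mul ((h.inv₀ h0).comp t2)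
  rw [mul_inv_cancel₀ h0, one_mul] at hlim
  refine (hlim.mul_const (gaussTerm r y n)).congr' ?_
  filter_upwards [eventually_ge_atTop n.natAbs] with N hN
  rw [tripleTerm, if_pos hN]
  have e : 2 * N = (n + N).toNat + ((N : ℤ) - n).toNat := by omega
  have := gaussBinom_eq_div hr (n + N).toNat ((N : ℤ) - n).toNat
  rw [← e] at this
  rw [this]
  rfl

/-- The Jacobi triple product identity. -/
lemma phi_mul_theta {r x : ℂ} (hr0 : r ≠ 0) (hr : ‖r‖ < 1) (hx : x ≠ 0) :
    phi (r ^ 2) (r ^ 2) * theta x (r ^ 2) = gaussSum r (-x / r) := by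
  have hp : ‖r ^ 2‖ < 1 := by
    rw [norm_pow]; exact pow_lt_one₀ (norm_nonneg r) hr two_ne_zero
  have hy : -x / r ≠ 0 := div_ne_zero (neg_ne_zero.2 hx) hr0
  have h0 := phi_self_ne_zero hp
  obtain ⟨B, hB0, hB⟩ := exists_gaussBinom_bound hp
  have h1 : Tendsto (fun N => ∑' n : ℤ, tripleTerm r (-x / r) N n) atTop
      (𝓝 (∑' n : ℤ, (phi (r ^ 2) (r ^ 2))⁻¹ * gaussTerm r (-x / r) n)) := by
    refine tendsto_tsum_of_dominated_convergence
      (bound := fun n => B * ‖gaussTerm r (-x / r) n‖)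
      ((summable_norm_gaussTerm hr0 hr hy).mul_left B) (tendsto_tripleTerm hp _) ?_
    refine Eventually.of_forall fun N n => ?_
    rw [tripleTerm]
    split_ifs with h
    · rw [norm_mul]
      gcongr
      have e : 2 * N = (n + N).toNat + ((N : ℤ) - n).toNat := by omega
      rw [e]
      exact hB _ _
    · rw [norm_zero]; positivity
  have h2 := (tendsto_phi hp x).mul (tendsto_phi hp (r ^ 2 / x))
  simp only [prod_mul_prod_eq_sum hr0 hx, ← tsum_tripleTerm] at h2
  rw [theta_eq_phi_mul_phi hp, tendsto_nhds_unique h2 h1, tsum_mul_left, gaussSum]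
  field_simp

/-! ### The addition formula: `θ(xy, x/y; p)` as a determinant of rank two. -/

/-- `(s, d) ↦ (s + d, s - d)` and `(s, d) ↦ (s + d + 1, s - d)` partition `ℤ × ℤ`. -/
def parityEquiv : (ℤ × ℤ) ⊕ (ℤ × ℤ) ≃ ℤ × ℤ where
  toFun := Sum.elim (fun t => (t.1 + t.2, t.1 - t.2)) fun t => (t.1 + t.2 + 1, t.1 - t.2)
  invFun t := if (t.1 + t.2) % 2 = 0 then Sum.inl ((t.1 + t.2) / 2, (t.1 - t.2) / 2)
    else Sum.inr ((t.1 + t.2) / 2, (t.1 - t.2) / 2)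
  left_inv := by
    rintro (⟨s, d⟩ | ⟨s, d⟩)
    · have h : (s + d + (s - d)) % 2 = 0 := by omega
      simp only [Sum.elim_inl, h, if_true, Sum.inl.injEq, Prod.mk.injEq]
      omega
    · have h : ¬ (s + d + 1 + (s - d)) % 2 = 0 := by omega
      simp only [Sum.elim_inr, h, if_false, Sum.inr.injEq, Prod.mk.injEq]
      omega
  right_inv := by
    rintro ⟨m, n⟩
    by_cases h : (m + n) % 2 = 0
    · simp only [h, if_true, Sum.elim_inl, Prod.mk.injEq]
      omega
    · simp only [h, if_false, Sum.elim_inr, Prod.mk.injEq]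
      omega

/-- By `(s+d)² + (s-d)² = 2s² + 2d²` the variables separate, with `r²` in place of `r`. Pairs of
opposite parity give the second term of `gaussSum_mul`. -/
lemma gaussTerm_mul_even {r u v : ℂ} (hr0 : r ≠ 0) (hu : u ≠ 0) (hv : v ≠ 0) (s d : ℤ) :
    gaussTerm r u (s + d) * gaussTerm r v (s - d)
      = gaussTerm (r ^ 2) (u * v) s * gaussTerm (r ^ 2) (u / v) d := by
  have e : ∀ n : ℤ, (r ^ 2) ^ n = r ^ (2 * n) := fun n => by rw [zpow_mul]; norm_cast
  have e1 : r ^ ((s + d) * (s + d)) * r ^ ((s - d) * (s - d))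
      = (r ^ 2) ^ (s * s) * (r ^ 2) ^ (d * d) := by
    rw [e, e, ← zpow_add₀ hr0, ← zpow_add₀ hr0]; congr 1; ring
  simp only [gaussTerm]
  rw [mul_mul_mul_comm, e1, zpow_add₀ hu, zpow_sub₀ hv, mul_zpow, div_zpow]
  ring

lemma gaussTerm_mul_odd {r u v : ℂ} (hr0 : r ≠ 0) (hu : u ≠ 0) (hv : v ≠ 0) (s d : ℤ) :
    gaussTerm r u (s + d + 1) * gaussTerm r v (s - d)
      = r * u * (gaussTerm (r ^ 2) (r ^ 2 * (u * v)) s *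
          gaussTerm (r ^ 2) (r ^ 2 * (u / v)) d) := by
  have e : ∀ n : ℤ, (r ^ 2) ^ n = r ^ (2 * n) := fun n => by rw [zpow_mul]; norm_cast
  have e1 : r ^ ((s + d + 1) * (s + d + 1)) * r ^ ((s - d) * (s - d))
      = r * ((r ^ 2) ^ (s * s) * (r ^ 2) ^ s * ((r ^ 2) ^ (d * d) * (r ^ 2) ^ d)) := by
    simp only [e]
    rw [← zpow_add₀ hr0, ← zpow_add₀ hr0, ← zpow_add₀ hr0, ← zpow_add₀ hr0, ← zpow_one_add₀ hr0]
    congr 1; ring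
  simp only [gaussTerm]
  rw [mul_mul_mul_comm, e1, zpow_add₀ hu, zpow_add₀ hu, zpow_one, zpow_sub₀ hv]
  simp only [mul_zpow, div_zpow]
  ring

lemma gaussSum_mul {r u v : ℂ} (hr0 : r ≠ 0) (hr : ‖r‖ < 1) (hu : u ≠ 0) (hv : v ≠ 0) :
    gaussSum r u * gaussSum r v = gaussSum (r ^ 2) (u * v) * gaussSum (r ^ 2) (u / v)
      + r * u * (gaussSum (r ^ 2) (r ^ 2 * (u * v)) * gaussSum (r ^ 2) (r ^ 2 * (u / v))) := by
  have hp : ‖r ^ 2‖ < 1 := by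
    rw [norm_pow]; exact pow_lt_one₀ (norm_nonneg r) hr two_ne_zero
  have hp0 : r ^ 2 ≠ 0 := pow_ne_zero 2 hr0
  have hs := fun {y : ℂ} (hy : y ≠ 0) => summable_norm_gaussTerm hr0 hr hy
  have hs' := fun {y : ℂ} (hy : y ≠ 0) => summable_norm_gaussTerm hp0 hp hy
  have h1 : u * v ≠ 0 := mul_ne_zero hu hv
  have h2 : u / v ≠ 0 := div_ne_zero hu hv
  have h3 := mul_ne_zero hp0 h1
  have h4 := mul_ne_zero hp0 h2
  simp only [gaussSum]
  rw [tsum_mul_tsum_of_summable_norm (hs hu) (hs hv),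
    tsum_mul_tsum_of_summable_norm (hs' h1) (hs' h2),
    tsum_mul_tsum_of_summable_norm (hs' h3) (hs' h4), ← tsum_mul_left, ← parityEquiv.tsum_eq,
    Summable.tsum_sum]
  · congr 1
    · exact tsum_congr fun t => gaussTerm_mul_even hr0 hu hv t.1 t.2
    · exact tsum_congr fun t => gaussTerm_mul_odd hr0 hu hv t.1 t.2
  · exact (summable_mul_of_summable_norm (hs' h1) (hs' h2)).congr
      fun t => (gaussTerm_mul_even hr0 hu hv t.1 t.2).symm
  · exact ((summable_mul_of_summable_norm (hs' h3) (hs' h4)).mul_left (r * u)).congr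
      fun t => (gaussTerm_mul_odd hr0 hu hv t.1 t.2).symm

/-- Quasi-periodicity, from shifting the summation index by one. -/
lemma gaussSum_div {p y : ℂ} (hp0 : p ≠ 0) (hy : y ≠ 0) :
    gaussSum p (y / p) = y * gaussSum p (p * y) := by
  simp only [gaussSum]
  rw [← tsum_mul_left, ← (Equiv.addRight (1 : ℤ)).tsum_eq]
  refine tsum_congr fun n => ?_
  simp only [Equiv.coe_addRight, gaussTerm]
  rw [show (n + 1) * (n + 1) = n * n + n + n + 1 by ring, zpow_add₀ (div_ne_zero hy hp0)]
  simp only [zpow_add₀ hp0, mul_zpow, div_zpow, zpow_one]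
  field_simp

/-- `θ(xy, x/y; p) / x` is an antisymmetric function of rank two. -/
lemma exists_theta_mul_theta {p : ℂ} (hp : ‖p‖ < 1) : ∃ X Y : ℂ → ℂ, ∀ x y : ℂ, x ≠ 0 → y ≠ 0 →
    theta (x * y) p * theta (x / y) p = x * (X x * Y y - Y x * X y) := by
  -- The bilateral series needs `r ≠ 0`. For `p = 0` one has `(1-xy)(1-x/y) = x((x+1/x) - (y+1/y))`.
  rcases eq_or_ne p 0 with rfl | hp0
  · refine ⟨fun x => x + x⁻¹, fun _ => 1, fun x y hx hy => ?_⟩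
    have h : ∀ x, theta x 0 = 1 - x := fun x => by
      have h0 : ∀ y, phi 0 y = 1 - y := fun y => by
        rw [phi_eq_one_sub_mul (by simp)]; simp [phi]
      rw [theta_eq_phi_mul_phi hp, h0, h0]; simp
    rw [h, h]
    field_simp
    ring
  · obtain ⟨r, rfl⟩ := IsAlgClosed.exists_pow_nat_eq p two_pos
    have hr0 : r ≠ 0 := by rintro rfl; simp at hp0
    have hr : ‖r‖ < 1 := by
      by_contra h
      rw [norm_pow] at hp
      exact absurd (one_le_pow₀ (not_lt.1 h)) (not_le.2 hp)
    have h0 := phi_self_ne_zero hp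
    -- With `u = -xy/r` and `v = -x/(yr)`, `gaussSum_mul` involves `uv = x²/p` and `u/v = y²`.
    -- Quasi-periodicity replaces `x²/p` by `p x²`, so the same two functions occur in `x` and in
    -- `y`.
    refine ⟨fun x => x * gaussSum (r ^ 2) (r ^ 2 * x ^ 2) / phi (r ^ 2) (r ^ 2) ^ 2,
      fun x => gaussSum (r ^ 2) (x ^ 2), fun x y hx hy => ?_⟩
    have h1 := phi_mul_theta hr0 hr (mul_ne_zero hx hy)
    have h2 := phi_mul_theta hr0 hr (div_ne_zero hx hy)
    have hm := gaussSum_mul (u := -(x * y) / r) (v := -(x / y) / r) hr0 hr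
      (div_ne_zero (neg_ne_zero.2 (mul_ne_zero hx hy)) hr0)
      (div_ne_zero (neg_ne_zero.2 (div_ne_zero hx hy)) hr0)
    rw [← h1, ← h2] at hm
    have e1 : -(x * y) / r * (-(x / y) / r) = x ^ 2 / r ^ 2 := by field_simp
    have e2 : -(x * y) / r / (-(x / y) / r) = y ^ 2 := by field_simp
    have e3 : r ^ 2 * (x ^ 2 / r ^ 2) = x ^ 2 := by field_simp
    rw [e1, e2, e3, gaussSum_div hp0 (pow_ne_zero 2 hx)] at hm
    have e4 : r * (-(x * y) / r) = -(x * y) := by field_simp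
    rw [e4] at hm
    have : theta (x * y) (r ^ 2) * theta (x / y) (r ^ 2)
        = (phi (r ^ 2) (r ^ 2) * theta (x * y) (r ^ 2) *
          (phi (r ^ 2) (r ^ 2) * theta (x / y) (r ^ 2))) / phi (r ^ 2) (r ^ 2) ^ 2 := by
      field_simp
    rw [this, hm]
    field_simp
    ring

/-! ### Lagrange interpolation and theta polynomials. -/

/-- Lagrange interpolation for products of values of an alternating form of rank two. -/
lemma prod_alternating_eq_sum {K S : Type*} [Field K] {X Y : S → K} {g : S → S → K}
    (hg : ∀ x y, g x y = X x * Y y - Y x * X y) (b x : ℕ → S) (n : ℕ)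
    (hx : ∀ i ≤ n, ∀ j ≤ n, i ≠ j → g (x i) (x j) ≠ 0) (z : S) :
    ∏ t ∈ Finset.range n, g (b t) z
      = ∑ k ∈ Finset.range (n + 1), (∏ t ∈ Finset.range n, g (b t) (x k)) *
          ∏ j ∈ (Finset.range (n + 1)).erase k, (g (x j) z / g (x j) (x k)) := by
  induction n generalizing z with
  | zero => simp
  | succ n ih =>
    have ih' := ih fun i hi j hj => hx i (by omega) j (by omega)
    have hR : ∀ k ∈ Finset.range (n + 1),
        (Finset.range (n + 1 + 1)).erase k = insert (n + 1) ((Finset.range (n + 1)).erase k) := by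
      intro k hk
      rw [Finset.range_add_one (n := n + 1), Finset.erase_insert_of_ne]
      rw [Finset.mem_range] at hk; omega
    have hR' : (Finset.range (n + 1 + 1)).erase (n + 1) = Finset.range (n + 1) := by
      rw [Finset.range_add_one (n := n + 1), Finset.erase_insert (by simp)]
    -- The induction hypothesis is used at `z` and also at the new node `x (n + 1)`, so that both
    -- sides become sums over the old nodes and can be compared termwise.
    rw [Finset.sum_range_succ, hR', Finset.prod_range_succ, ih' z,
      Finset.prod_range_succ _ n (M := K), ih' (x (n + 1)), Finset.sum_mul, Finset.sum_mul,
      Finset.sum_mul, ← Finset.sum_add_distrib]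
    refine Finset.sum_congr rfl fun k hk => ?_
    rw [hR k hk, Finset.prod_insert (by simp), Finset.prod_range_succ]
    have hk' : k ≤ n := by rw [Finset.mem_range] at hk; omega
    have h1 := hx (n + 1) le_rfl k (by omega) (by omega)
    have h2 := hx k (by omega) (n + 1) le_rfl (by omega)
    have e : (∏ j ∈ (Finset.range (n + 1)).erase k, (g (x j) (x (n + 1)) / g (x j) (x k))) *
        ∏ j ∈ Finset.range (n + 1), (g (x j) z / g (x j) (x (n + 1)))
        = (∏ j ∈ (Finset.range (n + 1)).erase k, (g (x j) z / g (x j) (x k))) *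
          (g (x k) z / g (x k) (x (n + 1))) := by
      rw [← Finset.prod_erase_mul _ _ hk, ← mul_assoc, ← Finset.prod_mul_distrib]
      congr 1
      refine Finset.prod_congr rfl fun j hj => ?_
      rw [Finset.mem_erase, Finset.mem_range] at hj
      have := hx j (by omega) (n + 1) le_rfl (by omega)
      have := hx j (by omega) k (by omega) hj.1
      field_simp
    -- The Plücker relation: the new factor `g (b n)` is interpolated between the two nodes `x k`
    -- and `x (n + 1)`.
    have pl : g (b n) z = g (b n) (x k) * (g (x (n + 1)) z / g (x (n + 1)) (x k))
        + g (b n) (x (n + 1)) * (g (x k) z / g (x k) (x (n + 1))) := by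
      have anti : g (x (n + 1)) (x k) = - g (x k) (x (n + 1)) := by rw [hg, hg]; ring
      rw [anti, div_neg]
      field_simp
      simp only [hg]
      ring
    calc _ = (∏ t ∈ Finset.range n, g (b t) (x k)) *
          (∏ j ∈ (Finset.range (n + 1)).erase k, (g (x j) z / g (x j) (x k))) * g (b n) z := by ring
      _ = (∏ t ∈ Finset.range n, g (b t) (x k)) * g (b n) (x k) *
          ((g (x (n + 1)) z / g (x (n + 1)) (x k)) *
            ∏ j ∈ (Finset.range (n + 1)).erase k, (g (x j) z / g (x j) (x k))) +
          (∏ t ∈ Finset.range n, g (b t) (x k)) * g (b n) (x (n + 1)) *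
          ((∏ j ∈ (Finset.range (n + 1)).erase k, (g (x j) z / g (x j) (x k))) *
            (g (x k) z / g (x k) (x (n + 1)))) := by rw [pl]; ring
      _ = _ := by rw [← e]; ring

/-- `f` agrees on `ℂ \ {0}` with a constant multiple of a product of `n` functions
`z ↦ θ(b z, b / z; p)`. -/
def IsThetaPoly (p : ℂ) (n : ℕ) (f : ℂ → ℂ) : Prop :=
  ∃ (c : ℂ) (b : ℕ → ℂ), (∀ t, b t ≠ 0) ∧
    ∀ z, z ≠ 0 → f z = c * ∏ t ∈ Finset.range n, (theta (b t * z) p * theta (b t / z) p)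

namespace IsThetaPoly

variable {p : ℂ}

lemma congr {n : ℕ} {f g : ℂ → ℂ} (hf : IsThetaPoly p n f) (h : ∀ z, z ≠ 0 → g z = f z) :
    IsThetaPoly p n g := by
  obtain ⟨c, b, hb, e⟩ := hf
  exact ⟨c, b, hb, fun z hz => (h z hz).trans (e z hz)⟩

lemma const (c : ℂ) : IsThetaPoly p 0 fun _ => c :=
  ⟨c, fun _ => 1, fun _ => one_ne_zero, fun z _ => by simp⟩

lemma mul {m n : ℕ} {f g : ℂ → ℂ} (hf : IsThetaPoly p m f) (hg : IsThetaPoly p n g) :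
    IsThetaPoly p (m + n) fun z => f z * g z := by
  obtain ⟨c, b, hb, e⟩ := hf
  obtain ⟨c', b', hb', e'⟩ := hg
  refine ⟨c * c', fun t => if t < m then b t else b' (t - m), fun t => ?_, fun z hz => ?_⟩
  · dsimp only
    split_ifs
    exacts [hb t, hb' _]
  · dsimp only
    rw [e z hz, e' z hz, Finset.prod_range_add]
    have h1 : ∏ t ∈ Finset.range m, (theta ((if t < m then b t else b' (t - m)) * z) p *
        theta ((if t < m then b t else b' (t - m)) / z) p)
        = ∏ t ∈ Finset.range m, (theta (b t * z) p * theta (b t / z) p) :=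
      Finset.prod_congr rfl fun t ht => by rw [if_pos (Finset.mem_range.1 ht)]
    rw [h1]
    simp
    ring

lemma prod {ι : Type*} (s : Finset ι) {n : ι → ℕ} {f : ι → ℂ → ℂ}
    (h : ∀ i ∈ s, IsThetaPoly p (n i) (f i)) :
    IsThetaPoly p (∑ i ∈ s, n i) fun z => ∏ i ∈ s, f i z := by
  classical
  induction s using Finset.induction_on with
  | empty => simpa using const 1
  | insert i s hi ih =>
    simp only [Finset.sum_insert hi, Finset.prod_insert hi]
    exact (h i (by simp)).mul (ih fun j hj => h j (by simp [hj]))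

lemma pow {n : ℕ} {f : ℂ → ℂ} (h : IsThetaPoly p n f) (w : ℕ) :
    IsThetaPoly p (w * n) fun z => f z ^ w := by
  simpa using prod (Finset.range w) (n := fun _ => n) (f := fun _ => f) fun _ _ => h

lemma theta_pair {b : ℂ} (hb : b ≠ 0) :
    IsThetaPoly p 1 fun z => theta (b * z) p * theta (b / z) p :=
  ⟨1, fun _ => b, fun _ => hb, fun z _ => by simp⟩

lemma continuousAt (hp : ‖p‖ < 1) {n : ℕ} {f : ℂ → ℂ} (h : IsThetaPoly p n f) {z : ℂ}
    (hz : z ≠ 0) : ContinuousAt f z := by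
  obtain ⟨c, b, hb, e⟩ := h
  have : ContinuousAt
      (fun z => c * ∏ t ∈ Finset.range n, (theta (b t * z) p * theta (b t / z) p)) z := by
    refine continuousAt_const.mul (tendsto_finsetProd _ fun t _ => ContinuousAt.mul ?_ ?_)
    · exact (continuousAt_theta hp (mul_ne_zero (hb t) hz)).comp
        (f := fun z => b t * z) (by fun_prop)
    · exact (continuousAt_theta hp (div_ne_zero (hb t) hz)).comp
        (f := fun z => b t / z) (continuousAt_const.div continuousAt_id hz)
  exact this.congr ((eventually_ne_nhds hz).mono fun y hy => (e y hy).symm)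

/-- Lagrange interpolation for theta functions. -/
lemma eq_sum (hp : ‖p‖ < 1) {n : ℕ} {f : ℂ → ℂ} (h : IsThetaPoly p n f) {x : ℕ → ℂ}
    (hx0 : ∀ k, x k ≠ 0)
    (hx : ∀ i ≤ n, ∀ j ≤ n, i ≠ j → theta (x i * x j) p * theta (x i / x j) p ≠ 0)
    {z : ℂ} (hz : z ≠ 0) :
    f z = ∑ k ∈ Finset.range (n + 1), f (x k) * ∏ j ∈ (Finset.range (n + 1)).erase k,
      ((theta (x j * z) p * theta (x j / z) p) /
        (theta (x j * x k) p * theta (x j / x k) p)) := by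
  obtain ⟨X, Y, hXY⟩ := exists_theta_mul_theta hp
  obtain ⟨c, b, hb, e⟩ := h
  set g : ℂ → ℂ → ℂ := fun x y => X x * Y y - Y x * X y with hg
  have key := prod_alternating_eq_sum (g := g) (fun _ _ => rfl) b x n
    (fun i hi j hj hij h0 => hx i hi j hj hij (by
      rw [hXY _ _ (hx0 i) (hx0 j)]; exact mul_eq_zero_of_right _ h0)) z
  -- The prefactors `b t` do not depend on `y` and join the constant; in the Lagrange quotients the
  -- prefactors `x j` cancel.
  have hP : ∀ y, y ≠ 0 → f y = (c * ∏ t ∈ Finset.range n, b t) *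
      ∏ t ∈ Finset.range n, g (b t) y := fun y hy => by
    rw [e y hy, mul_assoc, ← Finset.prod_mul_distrib]
    simp only [hg, hXY _ _ (hb _) hy]
  rw [hP z hz, key, Finset.mul_sum]
  refine Finset.sum_congr rfl fun k _ => ?_
  have hL : ∏ j ∈ (Finset.range (n + 1)).erase k, ((theta (x j * z) p * theta (x j / z) p) /
        (theta (x j * x k) p * theta (x j / x k) p))
      = ∏ j ∈ (Finset.range (n + 1)).erase k, (g (x j) z / g (x j) (x k)) :=
    Finset.prod_congr rfl fun j _ => by
      rw [hXY _ _ (hx0 j) hz, hXY _ _ (hx0 j) (hx0 k), mul_div_mul_left _ _ (hx0 j)]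
  rw [hP _ (hx0 k), hL, mul_assoc _ _ (Finset.prod _ _)]

end IsThetaPoly

/-! ### Theta shifted factorials of nonnegative index. -/

/-- `(x; q, p)_n` for a natural number `n`. -/
noncomputable def thetaFacNat (q p x : ℂ) (n : ℕ) : ℂ :=
  ∏ k ∈ Finset.range n, theta (x * q ^ k) p

section thetaFacNat

variable {q p : ℂ}

lemma thetaFac_natCast (x : ℂ) (n : ℕ) : thetaFac x q p (n : ℤ) = thetaFacNat q p x n := rfl

lemma thetaFac_neg_natCast (hq : q ≠ 0) (x : ℂ) (n : ℕ) :
    thetaFac x q p (-(n : ℤ)) = (thetaFacNat q p (x * q ^ (-(n : ℤ))) n)⁻¹ := by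
  cases n with
  | zero => simp [thetaFac, thetaFacNat, show (0 : ℤ) = Int.ofNat 0 from rfl, -Int.ofNat_eq_natCast]
  | succ n =>
    rw [show (-((n + 1 : ℕ) : ℤ)) = Int.negSucc n from rfl]
    simp only [thetaFac, thetaFacNat, one_div, zpow_add₀ hq, zpow_natCast, mul_assoc]

lemma thetaFacNat_add (x : ℂ) (m n : ℕ) :
    thetaFacNat q p x (m + n) = thetaFacNat q p x m * thetaFacNat q p (x * q ^ m) n := by
  simp only [thetaFacNat, Finset.prod_range_add, pow_add, mul_assoc]

lemma thetaFacNat_one (x : ℂ) : thetaFacNat q p x 1 = theta x p := by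
  simp [thetaFacNat]

lemma thetaFacNat_ne_zero_iff {x : ℂ} {n : ℕ} :
    thetaFacNat q p x n ≠ 0 ↔ ∀ k < n, theta (x * q ^ k) p ≠ 0 := by
  simp [thetaFacNat, Finset.prod_ne_zero_iff]

/-- Invert the argument of every factor by `theta_inv`, then reverse the order of the factors. -/
lemma thetaFacNat_reflect (hp : ‖p‖ < 1) (hq : q ≠ 0) {x : ℂ} (hx : x ≠ 0) (k : ℕ) :
    thetaFacNat q p x k
      = (-x) ^ k * q ^ (k.choose 2) * thetaFacNat q p (q ^ (1 - (k : ℤ)) / x) k := by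
  have h1 : ∀ j : ℕ, theta (x * q ^ j) p = -x * q ^ j * theta (x⁻¹ * q ^ (-(j : ℤ))) p := fun j => by
    have h0 : x * q ^ j ≠ 0 := mul_ne_zero hx (pow_ne_zero _ hq)
    have := theta_inv hp (inv_ne_zero h0)
    rw [inv_inv] at this
    rw [this, mul_inv, zpow_neg, zpow_natCast]
    ring
  simp only [thetaFacNat, h1, Finset.prod_mul_distrib, Finset.prod_const, Finset.card_range,
    Nat.choose_two_right]
  congr 1
  · rw [← Finset.sum_range_id, Finset.prod_pow_eq_pow_sum]
  rw [← Finset.prod_range_reflect]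
  refine Finset.prod_congr rfl fun j hj => ?_
  rw [Finset.mem_range] at hj
  congr 1
  rw [div_eq_inv_mul, mul_assoc, ← zpow_natCast q j, ← zpow_add₀ hq]
  congr 2
  omega

/-- With `n = k + d`, the nodes other than the `k`-th form two blocks, each of which gives a shifted
factorial. -/
lemma prod_erase_range {M : Type*} [CommMonoid M] (h : ℕ → M) (k d : ℕ) :
    ∏ j ∈ (Finset.range (k + d + 1)).erase k, h j
      = (∏ j ∈ Finset.range k, h j) * ∏ i ∈ Finset.range d, h (k + 1 + i) := by
  induction d with
  | zero => rw [add_zero, Finset.range_add_one, Finset.erase_insert (by simp)]; simp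
  | succ d ih =>
    rw [Finset.range_add_one, Finset.erase_insert_of_ne (by omega), Finset.prod_insert (by simp),
      show k + (d + 1) = k + d + 1 by ring, ih, Finset.prod_range_succ,
      show k + 1 + d = k + d + 1 by ring]
    rw [mul_comm, mul_assoc]

end thetaFacNat

/-! ### One-variable interpolation at the nodes `a q^k`. -/

section

variable {q p : ℂ}

lemma continuousAt_thetaFacNat (hp : ‖p‖ < 1) (hq : q ≠ 0) {f : ℂ → ℂ} {a : ℂ}
    (hf : ContinuousAt f a) (h0 : f a ≠ 0) (n : ℕ) :
    ContinuousAt (fun x => thetaFacNat q p (f x) n) a :=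
  tendsto_finsetProd _ fun k _ =>
    (continuousAt_theta hp (mul_ne_zero h0 (pow_ne_zero k hq))).comp
      (f := fun x => f x * q ^ k) (hf.mul continuousAt_const)

/-- The coefficient of `f (a q ^ k)` in the interpolation of `f z` at the points `a q ^ k`. -/
noncomputable def kernel (q p a z : ℂ) (n k : ℕ) : ℂ :=
  q ^ ((n + 1) * k) * (theta (a ^ 2 * q ^ (2 * k)) p / theta (a ^ 2) p) *
    (thetaFacNat q p (q ^ (-(n : ℤ))) k * thetaFacNat q p (a ^ 2) k *
        thetaFacNat q p (a * z) k * thetaFacNat q p (a / z) k /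
      (thetaFacNat q p q k * thetaFacNat q p (a ^ 2 * q ^ (n + 1)) k *
        thetaFacNat q p (a * q * z) k * thetaFacNat q p (a * q / z) k))

/-- With `n = k + d`, this is `(q)_n / ((q^{-k})_k (q)_d) = q^{(n+1)k} (q^{-n})_k / (q)_k`,
cross-multiplied. Two reflections produce the power of `q`, and their signs cancel. -/
lemma thetaFacNat_q_mul (hp : ‖p‖ < 1) (hq : q ≠ 0) (k d : ℕ) :
    thetaFacNat q p q (k + d) * thetaFacNat q p q k
      = q ^ ((k + d + 1) * k) * thetaFacNat q p (q ^ (-((k + d : ℕ) : ℤ))) k *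
        thetaFacNat q p (q ^ (-(k : ℤ))) k * thetaFacNat q p q d := by
  rw [add_comm k d, thetaFacNat_add, thetaFacNat_reflect hp hq (mul_ne_zero hq (pow_ne_zero d hq)) k]
  rw [thetaFacNat_reflect hp hq hq k]
  have e1 : q ^ (1 - (k : ℤ)) / (q * q ^ d) = q ^ (-((d + k : ℕ) : ℤ)) := by
    rw [← pow_succ', ← zpow_natCast q (d + 1), ← zpow_sub₀ hq]
    congr 1; push_cast; ring
  have e2 : q ^ (1 - (k : ℤ)) / q = q ^ (-(k : ℤ)) := by
    rw [div_eq_iff hq, ← zpow_add_one₀ hq]; congr 1; ring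
  have e3 : (-(q * q ^ d)) ^ k * q ^ (k.choose 2) * ((-q) ^ k * q ^ (k.choose 2))
      = q ^ ((d + k + 1) * k) := by
    have h1 : (q ^ 2) ^ (k.choose 2) * q ^ k = q ^ (k * k) := pow_choose_two_mul q k
    have h2 : (-1 : ℂ) ^ k * (-1) ^ k = 1 := by rw [← mul_pow]; simp
    rw [neg_pow (q * q ^ d), neg_pow q, show (d + k + 1) * k = k * k + (d * k + k) by ring, pow_add,
      ← h1, pow_add, pow_mul q d k, ← pow_mul, two_mul, pow_add, mul_pow]
    linear_combination ((q ^ k * (q ^ d) ^ k) * q ^ k.choose 2 * (q ^ k * q ^ k.choose 2)) * h2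
  rw [e1, e2, ← e3]
  ring

/-- Both sides are `(a²; q, p)_{2k+d+1}`, cut into blocks in two ways. -/
lemma thetaFacNat_sq_mul (a : ℂ) (k d : ℕ) :
    thetaFacNat q p (a ^ 2 * q) (k + d) * theta (a ^ 2) p *
        thetaFacNat q p (a ^ 2 * q ^ (k + d + 1)) k
      = thetaFacNat q p (a ^ 2) k * thetaFacNat q p (a ^ 2 * q ^ k) k *
        theta (a ^ 2 * q ^ (2 * k)) p * thetaFacNat q p (a ^ 2 * q ^ (2 * k + 1)) d := by
  have h1 : thetaFacNat q p (a ^ 2) (1 + (k + d) + k) = thetaFacNat q p (a ^ 2 * q) (k + d) *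
      theta (a ^ 2) p * thetaFacNat q p (a ^ 2 * q ^ (k + d + 1)) k := by
    rw [thetaFacNat_add, thetaFacNat_add, thetaFacNat_one, pow_one, add_comm 1 (k + d)]
    ring
  have h2 : thetaFacNat q p (a ^ 2) (k + k + 1 + d) = thetaFacNat q p (a ^ 2) k *
      thetaFacNat q p (a ^ 2 * q ^ k) k *
        theta (a ^ 2 * q ^ (2 * k)) p * thetaFacNat q p (a ^ 2 * q ^ (2 * k + 1)) d := by
    rw [thetaFacNat_add, thetaFacNat_add, thetaFacNat_add, thetaFacNat_one, ← two_mul]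
  rw [← h1, ← h2]
  congr 1
  ring

lemma lagrange_coeff_eq_kernel (hp : ‖p‖ < 1) (hq : q ≠ 0) {a z : ℂ} (ha : a ≠ 0)
    {k d : ℕ} (hgen : ∀ j ≤ 2 * (k + d), theta (a ^ 2 * q ^ j) p ≠ 0)
    (hqn : thetaFacNat q p q (k + d) ≠ 0)
    (hz1 : thetaFacNat q p (a * q * z) (k + d) ≠ 0)
    (hz2 : thetaFacNat q p (a * q / z) (k + d) ≠ 0) :
    thetaFacNat q p (a ^ 2 * q) (k + d) * thetaFacNat q p q (k + d) /
        (thetaFacNat q p (a * q * z) (k + d) * thetaFacNat q p (a * q / z) (k + d)) *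
      ∏ j ∈ (Finset.range (k + d + 1)).erase k,
        ((theta (a * q ^ j * z) p * theta (a * q ^ j / z) p) /
          (theta (a * q ^ j * (a * q ^ k)) p * theta (a * q ^ j / (a * q ^ k)) p))
      = kernel q p a z (k + d) k := by
  have e1 := thetaFacNat_q_mul hp hq k d
  have e2 := thetaFacNat_sq_mul (q := q) (p := p) a k d
  have f1 : thetaFacNat q p (a * q * z) (k + d) = thetaFacNat q p (a * q * z) k *
      thetaFacNat q p (a * q * z * q ^ k) d := thetaFacNat_add _ _ _
  have f2 : thetaFacNat q p (a * q / z) (k + d) = thetaFacNat q p (a * q / z) k *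
      thetaFacNat q p (a * q / z * q ^ k) d := thetaFacNat_add _ _ _
  have hqn' : thetaFacNat q p q k ≠ 0 := fun h => hqn (by rw [thetaFacNat_add, h, zero_mul])
  have hT0 : theta (a ^ 2) p ≠ 0 := by simpa using hgen 0 (by omega)
  have hD1 : thetaFacNat q p (a ^ 2 * q ^ k) k ≠ 0 := thetaFacNat_ne_zero_iff.2 fun j hj => by
    rw [mul_assoc, ← pow_add]; exact hgen _ (by omega)
  have hD2 : thetaFacNat q p (a ^ 2 * q ^ (2 * k + 1)) d ≠ 0 :=
    thetaFacNat_ne_zero_iff.2 fun j hj => by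
      rw [mul_assoc, ← pow_add]; exact hgen _ (by omega)
  have hS : thetaFacNat q p (a ^ 2 * q ^ (k + d + 1)) k ≠ 0 :=
    thetaFacNat_ne_zero_iff.2 fun j hj => by
      rw [mul_assoc, ← pow_add]; exact hgen _ (by omega)
  have hVW := mul_ne_zero hqn hqn'
  rw [e1] at hVW
  have hQd := right_ne_zero_of_mul hVW
  have hV := right_ne_zero_of_mul (left_ne_zero_of_mul hVW)
  have p1 : ∏ j ∈ (Finset.range (k + d + 1)).erase k, theta (a * q ^ j * z) p
      = thetaFacNat q p (a * z) k * thetaFacNat q p (a * q * z * q ^ k) d := by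
    rw [prod_erase_range]
    congr 1 <;> refine Finset.prod_congr rfl fun j _ => ?_ <;> congr 1 <;> ring
  have p2 : ∏ j ∈ (Finset.range (k + d + 1)).erase k, theta (a * q ^ j / z) p
      = thetaFacNat q p (a / z) k * thetaFacNat q p (a * q / z * q ^ k) d := by
    rw [prod_erase_range]
    congr 1 <;> refine Finset.prod_congr rfl fun j _ => ?_ <;> congr 1 <;> ring
  have p3 : ∏ j ∈ (Finset.range (k + d + 1)).erase k, theta (a * q ^ j * (a * q ^ k)) p
      = thetaFacNat q p (a ^ 2 * q ^ k) k * thetaFacNat q p (a ^ 2 * q ^ (2 * k + 1)) d := by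
    rw [prod_erase_range]
    congr 1 <;> refine Finset.prod_congr rfl fun j _ => ?_ <;> congr 1 <;> ring
  have p4 : ∏ j ∈ (Finset.range (k + d + 1)).erase k, theta (a * q ^ j / (a * q ^ k)) p
      = thetaFacNat q p (q ^ (-(k : ℤ))) k * thetaFacNat q p q d := by
    rw [prod_erase_range]
    congr 1 <;> refine Finset.prod_congr rfl fun j _ => ?_ <;> congr 1
    · rw [zpow_neg, zpow_natCast]; field_simp
    · field_simp; ring
  rw [Finset.prod_div_distrib, Finset.prod_mul_distrib, Finset.prod_mul_distrib, p1, p2, p3, p4,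
    kernel]
  rw [f1] at hz1 ⊢
  rw [f2] at hz2 ⊢
  have hz1a := left_ne_zero_of_mul hz1
  have hz1b := right_ne_zero_of_mul hz1
  have hz2a := left_ne_zero_of_mul hz2
  have hz2b := right_ne_zero_of_mul hz2
  generalize thetaFacNat q p q (k + d) = Qn at *
  generalize thetaFacNat q p q k = Qk at *
  generalize thetaFacNat q p q d = Qd at *
  generalize thetaFacNat q p (q ^ (-(k : ℤ))) k = V at *
  generalize thetaFacNat q p (q ^ (-((k + d : ℕ) : ℤ))) k = W at *
  generalize thetaFacNat q p (a ^ 2 * q) (k + d) = R at *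
  generalize thetaFacNat q p (a ^ 2 * q ^ (k + d + 1)) k = S at *
  generalize thetaFacNat q p (a ^ 2 * q ^ k) k = D1 at *
  generalize thetaFacNat q p (a ^ 2 * q ^ (2 * k + 1)) d = D2 at *
  generalize thetaFacNat q p (a ^ 2) k = U at *
  generalize theta (a ^ 2 * q ^ (2 * k)) p = T at *
  generalize theta (a ^ 2) p = T0 at *
  generalize q ^ ((k + d + 1) * k) = Qp at *
  generalize thetaFacNat q p (a * q * z * q ^ k) d = B1 at *
  generalize thetaFacNat q p (a * q / z * q ^ k) d = B2 at *
  generalize thetaFacNat q p (a * q * z) k = C1 at *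
  generalize thetaFacNat q p (a * q / z) k = C2 at *
  generalize thetaFacNat q p (a * z) k = A1 at *
  generalize thetaFacNat q p (a / z) k = A2 at *
  have hl : R * Qn / (C1 * B1 * (C2 * B2)) * ((A1 * B1 * (A2 * B2)) / (D1 * D2 * (V * Qd)))
      = (R * T0 * S) * (Qn * Qk) * (A1 * A2) / (C1 * C2 * D1 * D2 * V * Qd * T0 * S * Qk) := by
    field_simp
  rw [hl, e1, e2]
  field_simp

lemma countable_setOf_theta_sq_mul (hp : ‖p‖ < 1) {c : ℂ} (hc : c ≠ 0) :
    {a : ℂ | theta (a ^ 2 * c) p = 0}.Countable := by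
  have h : {a : ℂ | theta (a ^ 2 * c) p = 0}
      ⊆ ⋃ x ∈ {x : ℂ | theta x p = 0}, {a : ℂ | a ^ 2 * c = x} := fun a ha => by
    simp only [Set.mem_iUnion]
    exact ⟨_, ha, rfl⟩
  refine ((countable_zeros_theta hp).biUnion fun x _ => ?_).mono h
  obtain ⟨s, hs⟩ := IsAlgClosed.exists_pow_nat_eq (x / c) two_pos
  refine (Set.toFinite {s, -s}).countable.mono fun a ha => ?_
  have : a ^ 2 = s ^ 2 := by
    rw [hs, eq_div_iff hc]; exact ha
  simpa using sq_eq_sq_iff_eq_or_eq_neg.1 this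

lemma frequently_generic (hp : ‖p‖ < 1) (hq : q ≠ 0) (n : ℕ) (a : ℂ) :
    ∃ᶠ x in 𝓝 a, ∀ j ≤ n, theta (x ^ 2 * q ^ j) p ≠ 0 := by
  have hc : (⋃ j : ℕ, {x : ℂ | theta (x ^ 2 * q ^ j) p = 0}).Countable :=
    Set.countable_iUnion fun j => countable_setOf_theta_sq_mul hp (pow_ne_zero j hq)
  refine (mem_closure_iff_frequently.1 (hc.dense_compl ℂ a)).mono fun x hx j _ h => ?_
  exact hx (Set.mem_iUnion.2 ⟨j, h⟩)

/-- Interpolation of a theta function at the points `a q ^ k`, `0 ≤ k ≤ n`. -/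
lemma IsThetaPoly.mul_eq_sum_kernel (hp : ‖p‖ < 1) (hq : q ≠ 0) {n : ℕ} {f : ℂ → ℂ}
    (hf : IsThetaPoly p n f) {a z : ℂ} (ha : a ≠ 0) (hz : z ≠ 0) (hT : theta (a ^ 2) p ≠ 0)
    (hqn : thetaFacNat q p q n ≠ 0) (hS : thetaFacNat q p (a ^ 2 * q ^ (n + 1)) n ≠ 0)
    (hz1 : thetaFacNat q p (a * q * z) n ≠ 0) (hz2 : thetaFacNat q p (a * q / z) n ≠ 0) :
    thetaFacNat q p (a ^ 2 * q) n * thetaFacNat q p q n /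
        (thetaFacNat q p (a * q * z) n * thetaFacNat q p (a * q / z) n) * f z
      = ∑ k ∈ Finset.range (n + 1), kernel q p a z n k * f (a * q ^ k) := by
  have hsub : ∀ {x : ℂ} {k : ℕ}, k ≤ n → thetaFacNat q p x n ≠ 0 → thetaFacNat q p x k ≠ 0 := by
    intro x k hk h
    exact thetaFacNat_ne_zero_iff.2 fun j hj => thetaFacNat_ne_zero_iff.1 h j (by omega)
  have c1 : ContinuousAt (fun x => thetaFacNat q p (x * q * z) n) a :=
    continuousAt_thetaFacNat hp hq (by fun_prop) (by simp [ha, hq, hz]) n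
  have c2 : ContinuousAt (fun x => thetaFacNat q p (x * q / z) n) a :=
    continuousAt_thetaFacNat hp hq (by fun_prop) (by simp [ha, hq, hz]) n
  have c3 : ContinuousAt (fun x => thetaFacNat q p (x ^ 2 * q) n) a :=
    continuousAt_thetaFacNat hp hq (by fun_prop) (by simp [ha, hq]) n
  have cl : ContinuousAt (fun x => thetaFacNat q p (x ^ 2 * q) n * thetaFacNat q p q n /
        (thetaFacNat q p (x * q * z) n * thetaFacNat q p (x * q / z) n) * f z) a :=
    ((c3.mul continuousAt_const).div (c1.mul c2) (mul_ne_zero hz1 hz2)).mul continuousAt_const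
  have cr : ContinuousAt
      (fun x => ∑ k ∈ Finset.range (n + 1), kernel q p x z n k * f (x * q ^ k)) a := by
    refine tendsto_finsetSum _ fun k hk => ?_
    have hk' : k ≤ n := by rw [Finset.mem_range] at hk; omega
    have d1 : ContinuousAt (fun x => theta (x ^ 2 * q ^ (2 * k)) p) a :=
      (continuousAt_theta hp (by simp [ha, hq])).comp (f := fun x => x ^ 2 * q ^ (2 * k))
        (by fun_prop)
    have d2 : ContinuousAt (fun x => theta (x ^ 2) p) a :=
      (continuousAt_theta hp (by simp [ha])).comp (f := fun x => x ^ 2) (by fun_prop)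
    have d3 : ContinuousAt (fun x => thetaFacNat q p (x ^ 2) k) a :=
      continuousAt_thetaFacNat hp hq (by fun_prop) (by simp [ha]) k
    have d4 : ContinuousAt (fun x => thetaFacNat q p (x * z) k) a :=
      continuousAt_thetaFacNat hp hq (by fun_prop) (by simp [ha, hz]) k
    have d5 : ContinuousAt (fun x => thetaFacNat q p (x / z) k) a :=
      continuousAt_thetaFacNat hp hq (by fun_prop) (by simp [ha, hz]) k
    have d6 : ContinuousAt (fun x => thetaFacNat q p (x ^ 2 * q ^ (n + 1)) k) a :=
      continuousAt_thetaFacNat hp hq (by fun_prop) (by simp [ha, hq]) k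
    have d7 : ContinuousAt (fun x => thetaFacNat q p (x * q * z) k) a :=
      continuousAt_thetaFacNat hp hq (by fun_prop) (by simp [ha, hq, hz]) k
    have d8 : ContinuousAt (fun x => thetaFacNat q p (x * q / z) k) a :=
      continuousAt_thetaFacNat hp hq (by fun_prop) (by simp [ha, hq, hz]) k
    have d9 : ContinuousAt (fun x => f (x * q ^ k)) a :=
      (hf.continuousAt hp (by simp [ha, hq])).comp (f := fun x => x * q ^ k) (by fun_prop)
    refine ContinuousAt.mul ?_ d9
    exact (continuousAt_const.mul (d1.div d2 hT)).mul
      ((((continuousAt_const.mul d3).mul d4).mul d5).div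
        (((continuousAt_const.mul d6).mul d7).mul d8)
        (mul_ne_zero (mul_ne_zero (mul_ne_zero (hsub hk' hqn) (hsub hk' hS)) (hsub hk' hz1))
          (hsub hk' hz2)))
  -- Nodes may collide at `a` itself, since `θ(a² q^j)` may vanish for `1 ≤ j ≤ n`. These factors
  -- cancel from `kernel`, so both sides are continuous at `a`, and it is enough to have equality at
  -- generic points arbitrarily close to `a`.
  have hgeneric : ∃ᶠ x in 𝓝 a, thetaFacNat q p (x ^ 2 * q) n * thetaFacNat q p q n /
        (thetaFacNat q p (x * q * z) n * thetaFacNat q p (x * q / z) n) * f z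
      = ∑ k ∈ Finset.range (n + 1), kernel q p x z n k * f (x * q ^ k) := by
    refine ((frequently_generic hp hq (2 * n) a).and_eventually
      (((c1.eventually_ne hz1).and (c2.eventually_ne hz2)).and (eventually_ne_nhds ha))).mono ?_
    rintro x ⟨hgen, ⟨h1, h2⟩, hx⟩
    have hqj : ∀ j, 1 ≤ j → j ≤ n → theta (q ^ j) p ≠ 0 := fun j h1 h2 => by
      have := thetaFacNat_ne_zero_iff.1 hqn (j - 1) (by omega)
      rwa [← pow_succ', show j - 1 + 1 = j by omega] at this
    rw [hf.eq_sum hp (x := fun k => x * q ^ k) (fun k => by simp [hx, hq]) ?_ hz, Finset.mul_sum]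
    · refine Finset.sum_congr rfl fun k hk => ?_
      obtain ⟨d, rfl⟩ : ∃ d, n = k + d := by
        rw [Finset.mem_range] at hk
        exact ⟨n - k, by omega⟩
      rw [← lagrange_coeff_eq_kernel hp hq hx hgen hqn h1 h2]
      ring
    · intro i hi j hj hij
      refine mul_ne_zero ?_ ?_
      · rw [show x * q ^ i * (x * q ^ j) = x ^ 2 * q ^ (i + j) by ring]
        exact hgen _ (by omega)
      · rw [mul_div_mul_left _ _ hx]
        rcases lt_or_gt_of_ne hij with h | h
        · have e : q ^ i / q ^ j = (q ^ (j - i))⁻¹ := by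
            rw [pow_sub₀ q hq h.le]; field_simp
          rw [e, theta_inv hp (pow_ne_zero _ hq)]
          exact mul_ne_zero (neg_ne_zero.2 (inv_ne_zero (pow_ne_zero _ hq)))
            (hqj _ (by omega) (by omega))
        · rw [div_eq_mul_inv, ← pow_sub₀ q hq h.le]
          exact hqj _ (by omega) (by omega)
  by_contra hne
  exact hgeneric (((cl.sub cr).eventually_ne (sub_ne_zero.2 hne)).mono fun x hx =>
    sub_ne_zero.1 hx)

end

/-! ### Iterating the interpolation over all variables. -/

lemma sum_piFinset_succ {M : Type*} [AddCommMonoid M] {m : ℕ} (S : Fin (m + 1) → Finset ℕ)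
    (f : (Fin (m + 1) → ℕ) → M) :
    ∑ k ∈ Fintype.piFinset S, f k
      = ∑ k₀ ∈ S 0, ∑ k ∈ Fintype.piFinset fun i => S i.succ, f (Fin.cons k₀ k) := by
  rw [← Finset.sum_product']
  refine Finset.sum_nbij' (fun k => (k 0, Fin.tail k)) (fun t => Fin.cons t.1 t.2) ?_ ?_ ?_ ?_ ?_
  · intro k hk
    simp only [Fintype.mem_piFinset, Finset.mem_product] at hk ⊢
    exact ⟨hk 0, fun i => hk i.succ⟩
  · intro t ht
    simp only [Fintype.mem_piFinset, Finset.mem_product] at ht ⊢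
    exact Fin.cases ht.1 ht.2
  · intro k _; simp
  · intro t _; simp
  · intro k _; simp

/-- Interpolate in the first coordinate, freeze it at a node, and induct. The one-variable identity
is needed at all nonzero `y` because the other coordinates are partly nodes and partly `z i`; the
weights do not depend on them. -/
lemma prod_mul_eq_sum_piFinset : ∀ {m : ℕ} (N : Fin m → ℕ) (A : Fin m → ℂ) (K x : Fin m → ℕ → ℂ)
    (z : Fin m → ℂ) (F : (Fin m → ℂ) → ℂ) (_ : ∀ i, z i ≠ 0) (_ : ∀ i k, x i k ≠ 0)
    (_ : ∀ i (y : Fin m → ℂ), (∀ j, y j ≠ 0) → A i * F (Function.update y i (z i))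
      = ∑ k ∈ Finset.range (N i + 1), K i k * F (Function.update y i (x i k))),
    (∏ i, A i) * F z = ∑ k ∈ Fintype.piFinset fun i => Finset.range (N i + 1),
      (∏ i, K i (k i)) * F fun i => x i (k i)
  | 0, N, A, K, x, z, F, hz, hx, h => by
    simp
    congr 1
    exact Subsingleton.elim _ _
  | m + 1, N, A, K, x, z, F, hz, hx, h => by
    have h0 := h 0 z hz
    rw [Function.update_eq_self] at h0
    rw [sum_piFinset_succ, Fin.prod_univ_succ, mul_assoc, mul_left_comm, h0, Finset.mul_sum]
    refine Finset.sum_congr rfl fun k₀ _ => ?_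
    have ih := prod_mul_eq_sum_piFinset (fun i => N i.succ) (fun i => A i.succ)
      (fun i => K i.succ) (fun i => x i.succ) (Fin.tail z) (fun y => F (Fin.cons (x 0 k₀) y))
      (fun i => hz i.succ) (fun i => hx i.succ) (fun i y hy => by
        have := h i.succ (Fin.cons (x 0 k₀) y)
          (Fin.cases (hx 0 k₀) hy)
        simpa only [← Fin.cons_update, Fin.tail] using this)
    have e : Function.update z 0 (x 0 k₀) = Fin.cons (x 0 k₀) (Fin.tail z) := by
      rw [← Fin.cons_self_tail z, Fin.update_cons_zero]; simp
    rw [e, mul_left_comm, ih, Finset.mul_sum]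
    refine Finset.sum_congr rfl fun k _ => ?_
    rw [Fin.prod_univ_succ, ← mul_assoc]
    congr 2
    funext i
    refine Fin.cases ?_ (fun i => ?_) i <;> simp

/-! ### Shifted factorials of integer index under shifts of the argument. -/

section

variable {q p : ℂ}

/-- Because `1 / 0 = 0`, nonvanishing at `-m` says that no factor of the denominator vanishes. Those
factors include the ones for every index from `-m` to `0`, so conditions at the two extreme indices
suffice. -/
lemma thetaFac_ne_zero_of_mem_Icc (hq : q ≠ 0) {x : ℂ} {m n : ℕ} {K : ℤ}
    (hn : thetaFac x q p n ≠ 0) (hm : thetaFac x q p (-(m : ℤ)) ≠ 0) (h1 : -(m : ℤ) ≤ K)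
    (h2 : K ≤ n) : thetaFac x q p K ≠ 0 := by
  obtain ⟨h, rfl | rfl⟩ := K.eq_nat_or_neg
  · rw [thetaFac_natCast, thetaFacNat_ne_zero_iff] at *
    exact fun k hk => hn k (by omega)
  · rw [thetaFac_neg_natCast hq, ne_eq, inv_eq_zero, ← ne_eq, thetaFacNat_ne_zero_iff] at hm ⊢
    intro k hk
    have := hm (m - h + k) (by omega)
    rw [mul_assoc, ← zpow_natCast, ← zpow_add₀ hq] at this ⊢
    convert this using 4
    omega

lemma thetaFac_natCast_ne_zero_of_le {x : ℂ} {n k : ℕ} (hn : thetaFac x q p n ≠ 0) (h : k ≤ n) :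
    thetaFac x q p k ≠ 0 := by
  rw [thetaFac_natCast, thetaFacNat_ne_zero_iff] at *
  exact fun j hj => hn j (by omega)

/-- Both sides are the two ways of splitting `(x; q, p)_{u+K}`; for `K < 0` the inverses must be
genuine. -/
lemma thetaFac_shift (hq : q ≠ 0) (x : ℂ) (u : ℕ) (K : ℤ)
    (h : K < 0 → thetaFac x q p K ≠ 0 ∧ thetaFac (x * q ^ u) q p K ≠ 0) :
    thetaFac (x * q ^ K) q p u * thetaFac x q p K
      = thetaFac (x * q ^ u) q p K * thetaFac x q p u := by
  rcases lt_or_ge K 0 with hK | hK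
  swap
  · obtain ⟨n, rfl⟩ := Int.eq_ofNat_of_zero_le hK
    simp only [thetaFac_natCast, zpow_natCast]
    rw [mul_comm, ← thetaFacNat_add, mul_comm (thetaFacNat q p (x * q ^ u) n), ← thetaFacNat_add,
      add_comm]
  · obtain ⟨n, rfl⟩ : ∃ n : ℕ, K = -(n : ℤ) := ⟨K.natAbs, by omega⟩
    obtain ⟨h1, h2⟩ := h hK
    rw [thetaFac_neg_natCast hq, ne_eq, inv_eq_zero] at h1 h2
    simp only [thetaFac_neg_natCast hq, thetaFac_natCast]
    have e1 : thetaFacNat q p (x * q ^ (-(n : ℤ))) u *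
        thetaFacNat q p (x * q ^ u * q ^ (-(n : ℤ))) n
        = thetaFacNat q p (x * q ^ (-(n : ℤ))) n * thetaFacNat q p x u := by
      have e2 : x = x * q ^ (-(n : ℤ)) * q ^ n := by
        rw [mul_assoc, ← zpow_natCast, ← zpow_add₀ hq]; simp
      conv_rhs => rw [e2]
      rw [mul_right_comm x, ← thetaFacNat_add, ← e2, add_comm, thetaFacNat_add, ← e2]
    generalize thetaFacNat q p (x * q ^ (-(n : ℤ))) n = A at *
    generalize thetaFacNat q p (x * q ^ u * q ^ (-(n : ℤ))) n = B at *
    field_simp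
    linear_combination e1

/-- The companion for a downward shift: split in two ways and reflect the blocks of length `|K|`.
The two reflection factors differ by `q^{uK}`. -/
lemma thetaFac_reflect_shift (hp : ‖p‖ < 1) (hq : q ≠ 0) {x : ℂ} (hx : x ≠ 0) (u : ℕ) (K : ℤ)
    (h : K < 0 → thetaFac (q ^ (1 - (u : ℤ)) / x) q p K ≠ 0 ∧ thetaFac (q / x) q p K ≠ 0) :
    q ^ (u * K) * thetaFac (x * q ^ (-K)) q p u * thetaFac (q ^ (1 - (u : ℤ)) / x) q p K
      = thetaFac (q / x) q p K * thetaFac x q p u := by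
  rcases lt_or_ge K 0 with hK | hK
  swap
  · obtain ⟨n, rfl⟩ := Int.eq_ofNat_of_zero_le hK
    have h1 := thetaFacNat_reflect (p := p) hp hq
      (mul_ne_zero hx (zpow_ne_zero (-(n : ℤ)) hq)) n
    have h2 := thetaFacNat_reflect (p := p) hp hq
      (mul_ne_zero (mul_ne_zero hx (pow_ne_zero u hq)) (zpow_ne_zero (-(n : ℤ)) hq)) n
    have e1 : q ^ (1 - (n : ℤ)) / (x * q ^ (-(n : ℤ))) = q / x := by
      rw [zpow_sub₀ hq, zpow_neg, zpow_one]; field_simp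
    have e2 : q ^ (1 - (n : ℤ)) / (x * q ^ u * q ^ (-(n : ℤ))) = q ^ (1 - (u : ℤ)) / x := by
      rw [zpow_sub₀ hq, zpow_sub₀ hq, zpow_neg, zpow_one, zpow_natCast, zpow_natCast]; field_simp
    rw [e1] at h1
    rw [e2] at h2
    have h3 : thetaFacNat q p (x * q ^ (-(n : ℤ))) u *
        thetaFacNat q p (x * q ^ u * q ^ (-(n : ℤ))) n
        = thetaFacNat q p (x * q ^ (-(n : ℤ))) n * thetaFacNat q p x u := by
      have e2 : x = x * q ^ (-(n : ℤ)) * q ^ n := by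
        rw [mul_assoc, ← zpow_natCast, ← zpow_add₀ hq]; simp
      conv_rhs => rw [e2]
      rw [mul_right_comm x, ← thetaFacNat_add, ← e2, add_comm, thetaFacNat_add, ← e2]
    rw [h1, h2] at h3
    simp only [thetaFac_natCast]
    have e3 : q ^ ((u : ℤ) * (n : ℤ)) = (q ^ u) ^ n := by
      rw [← pow_mul, ← zpow_natCast]; push_cast; rfl
    have hc : (-(x * q ^ (-(n : ℤ)))) ^ n * q ^ (n.choose 2) ≠ 0 :=
      mul_ne_zero (pow_ne_zero _ (neg_ne_zero.2 (mul_ne_zero hx (zpow_ne_zero _ hq))))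
        (pow_ne_zero _ hq)
    refine mul_left_cancel₀ hc ?_
    rw [e3, ← mul_assoc _ (thetaFacNat q p (q / x) n), ← h3]
    rw [show -(x * q ^ u * q ^ (-(n : ℤ))) = q ^ u * -(x * q ^ (-(n : ℤ))) by ring, mul_pow]
    ring
  · obtain ⟨n, rfl⟩ : ∃ n : ℕ, K = -(n : ℤ) := ⟨K.natAbs, by omega⟩
    obtain ⟨h1, h2⟩ := h hK
    rw [thetaFac_neg_natCast hq, ne_eq, inv_eq_zero] at h1 h2
    simp only [thetaFac_neg_natCast hq, thetaFac_natCast, neg_neg, zpow_natCast]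
    have r1 := thetaFacNat_reflect (p := p) hp hq hx n
    have r2 := thetaFacNat_reflect (p := p) hp hq (mul_ne_zero hx (pow_ne_zero u hq)) n
    have e1 : q ^ (1 - (n : ℤ)) / x = q / x * q ^ (-(n : ℤ)) := by
      rw [zpow_sub₀ hq, zpow_neg, zpow_one]; field_simp
    have e2 : q ^ (1 - (n : ℤ)) / (x * q ^ u) = q ^ (1 - (u : ℤ)) / x * q ^ (-(n : ℤ)) := by
      rw [zpow_sub₀ hq, zpow_sub₀ hq, zpow_neg, zpow_one, zpow_natCast, zpow_natCast]; field_simp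
    have h3 : thetaFacNat q p x n * thetaFacNat q p (x * q ^ n) u
        = thetaFacNat q p x u * thetaFacNat q p (x * q ^ u) n := by
      rw [← thetaFacNat_add, ← thetaFacNat_add, add_comm]
    rw [r1, r2, e1, e2] at h3
    have e3 : q ^ ((u : ℤ) * -(n : ℤ)) = ((q ^ u) ^ n)⁻¹ := by
      rw [← pow_mul, mul_neg, zpow_neg, ← zpow_natCast]; push_cast; rfl
    have hc : (-x) ^ n * q ^ (n.choose 2) ≠ 0 :=
      mul_ne_zero (pow_ne_zero _ (neg_ne_zero.2 hx)) (pow_ne_zero _ hq)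
    have h4 : thetaFacNat q p (q / x * q ^ (-(n : ℤ))) n * thetaFacNat q p (x * q ^ n) u
        = (q ^ u) ^ n * thetaFacNat q p x u *
          thetaFacNat q p (q ^ (1 - (u : ℤ)) / x * q ^ (-(n : ℤ))) n := by
      refine mul_left_cancel₀ hc ?_
      rw [← mul_assoc, h3, show -(x * q ^ u) = q ^ u * -x by ring, mul_pow]
      ring
    rw [e3]
    have hq' : (q ^ u) ^ n ≠ 0 := pow_ne_zero _ (pow_ne_zero _ hq)
    generalize thetaFacNat q p (q ^ (1 - (u : ℤ)) / x * q ^ (-(n : ℤ))) n = A at *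
    generalize thetaFacNat q p (q / x * q ^ (-(n : ℤ))) n = B at *
    field_simp
    linear_combination h4

/-- The effect on `(x, y; q, p)_u` of the shift `(x, y) ↦ (x q ^ K, y q ^ (-K))`. -/
lemma thetaFac_pair_shift (hp : ‖p‖ < 1) (hq : q ≠ 0) {x y : ℂ} (hy : y ≠ 0) (u : ℕ)
    (K : ℤ) (hxu : thetaFac x q p u ≠ 0) (hyu : thetaFac y q p u ≠ 0)
    (hxK : thetaFac x q p K ≠ 0) (hyK : thetaFac (q ^ (1 - (u : ℤ)) / y) q p K ≠ 0)
    (h : K < 0 → thetaFac (x * q ^ u) q p K ≠ 0 ∧ thetaFac (q / y) q p K ≠ 0) :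
    thetaFac (x * q ^ K) q p u * thetaFac (y * q ^ (-K)) q p u /
        (thetaFac x q p u * thetaFac y q p u) * q ^ (u * K)
      = thetaFac (x * q ^ u) q p K * thetaFac (q / y) q p K /
        (thetaFac x q p K * thetaFac (q ^ (1 - (u : ℤ)) / y) q p K) := by
  have h1 := thetaFac_shift hq x u K fun hK => ⟨hxK, (h hK).1⟩
  have h2 := thetaFac_reflect_shift hp hq hy u K fun hK => ⟨hyK, (h hK).2⟩
  rw [div_mul_eq_mul_div, div_eq_div_iff (mul_ne_zero hxu hyu) (mul_ne_zero hxK hyK)]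
  calc _ = (thetaFac (x * q ^ K) q p u * thetaFac x q p K) *
        (q ^ (u * K) * thetaFac (y * q ^ (-K)) q p u * thetaFac (q ^ (1 - (u : ℤ)) / y) q p K) := by
        ring
    _ = _ := by rw [h1, h2]; ring

/-! ### The building blocks as theta polynomials, and their degrees. -/

lemma isThetaPoly_thetaFac_pair (hq : q ≠ 0) {b : ℂ} (hb : b ≠ 0) (u : ℕ) :
    IsThetaPoly p u fun z => thetaFac (b * z) q p u * thetaFac (b / z) q p u :=
  ⟨1, fun t => b * q ^ t, fun t => mul_ne_zero hb (pow_ne_zero t hq), fun z _ => by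
    simp only [thetaFac_natCast, thetaFacNat, one_mul, ← Finset.prod_mul_distrib]
    refine Finset.prod_congr rfl fun t _ => ?_
    congr 2 <;> ring⟩

/-- The factor depending on a pair of variables. -/
noncomputable def pairFactor (q p : ℂ) (w : ℕ) {r : ℕ} (α : Fin r → ℂ) (u : Fin r → ℕ)
    (s t : ℂ) : ℂ :=
  s ^ (-(w : ℤ)) * thetas [s * t, s / t] p ^ w *
    ∏ l, thetaFacs [α l * s * t, α l * s / t, α l * t / s, α l / (s * t)] q p (u l)

/-- The factor `s^{-w}` is there for this: `θ(s/t) = -(s/t) θ(t/s)` gives `s⁻¹ θ(st, s/t) = -t⁻¹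
θ(ts, t/s)`. In the variable `t` that factor is a constant. -/
lemma isThetaPoly_pairFactor_left (hp : ‖p‖ < 1) (hq : q ≠ 0) (w : ℕ) {r : ℕ} {α : Fin r → ℂ}
    (hα : ∀ l, α l ≠ 0) (u : Fin r → ℕ) {t : ℂ} (ht : t ≠ 0) :
    IsThetaPoly p (w + 2 * ∑ l, u l) fun s => pairFactor q p w α u s t := by
  have h1 := ((IsThetaPoly.const (p := p) (-t⁻¹)).mul (IsThetaPoly.theta_pair (p := p) ht)).pow w
  have h2 := IsThetaPoly.prod (p := p) Finset.univ (n := fun l => u l + u l)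
    (f := fun l s => (thetaFac (α l * t * s) q p (u l) * thetaFac (α l * t / s) q p (u l)) *
      (thetaFac (α l / t * s) q p (u l) * thetaFac (α l / t / s) q p (u l))) fun l _ =>
    (isThetaPoly_thetaFac_pair hq (mul_ne_zero (hα l) ht) (u l)).mul
      (isThetaPoly_thetaFac_pair hq (div_ne_zero (hα l) ht) (u l))
  have e : w + 2 * ∑ l, u l = w * (0 + 1) + ∑ l, (u l + u l) := by
    rw [Finset.sum_add_distrib]; ring
  rw [e]
  refine (h1.mul h2).congr fun s hs => ?_
  rw [pairFactor]
  congr 1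
  · rw [zpow_neg, zpow_natCast, ← inv_pow, ← mul_pow]
    have := theta_inv hp (div_ne_zero ht hs)
    rw [inv_div] at this
    simp only [thetas, List.map_cons, List.map_nil, List.prod_cons, List.prod_nil, mul_one, this]
    congr 1
    rw [mul_comm s t]
    field_simp
  · refine Finset.prod_congr rfl fun l _ => ?_
    simp only [thetaFacs, List.map_cons, List.map_nil, List.prod_cons, List.prod_nil, mul_one]
    rw [mul_right_comm (α l) s t, mul_div_right_comm (α l) s t, div_mul_eq_div_div_swap]
    ring

lemma isThetaPoly_pairFactor_right (hq : q ≠ 0) (w : ℕ) {r : ℕ} {α : Fin r → ℂ}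
    (hα : ∀ l, α l ≠ 0) (u : Fin r → ℕ) {s : ℂ} (hs : s ≠ 0) :
    IsThetaPoly p (w + 2 * ∑ l, u l) fun t => pairFactor q p w α u s t := by
  have h1 := (IsThetaPoly.const (p := p) (s ^ (-(w : ℤ)))).mul
    ((IsThetaPoly.theta_pair (p := p) hs).pow w)
  have h2 := IsThetaPoly.prod (p := p) Finset.univ (n := fun l => u l + u l)
    (f := fun l t => (thetaFac (α l * s * t) q p (u l) * thetaFac (α l * s / t) q p (u l)) *
      (thetaFac (α l / s * t) q p (u l) * thetaFac (α l / s / t) q p (u l))) fun l _ =>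
    (isThetaPoly_thetaFac_pair hq (mul_ne_zero (hα l) hs) (u l)).mul
      (isThetaPoly_thetaFac_pair hq (div_ne_zero (hα l) hs) (u l))
  have e : w + 2 * ∑ l, u l = 0 + w * 1 + ∑ l, (u l + u l) := by
    rw [Finset.sum_add_distrib]; ring
  rw [e]
  refine (h1.mul h2).congr fun t ht => ?_
  rw [pairFactor]
  congr 1
  · simp only [thetas, List.map_cons, List.map_nil, List.prod_cons, List.prod_nil, mul_one]
  · refine Finset.prod_congr rfl fun l _ => ?_
    simp only [thetaFacs, List.map_cons, List.map_nil, List.prod_cons, List.prod_nil, mul_one]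
    rw [mul_div_right_comm (α l) t s, div_mul_eq_div_div]
    ring

end

lemma sum_sum_Ioi_ite {m : ℕ} (i₀ : Fin m) (D : Fin m → Fin m → ℕ) :
    ∑ i, ∑ j ∈ Finset.Ioi i, (if i = i₀ then D i j else if j = i₀ then D i j else 0)
      = ∑ j ∈ Finset.Iio i₀, D j i₀ + ∑ j ∈ Finset.Ioi i₀, D i₀ j := by
  have h : ∀ i, ∑ j ∈ Finset.Ioi i, (if i = i₀ then D i j else if j = i₀ then D i j else 0)
      = (if i < i₀ then D i i₀ else 0) + if i = i₀ then ∑ j ∈ Finset.Ioi i₀, D i₀ j else 0 := by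
    intro i
    rcases eq_or_ne i i₀ with rfl | hi
    · simp
    · simp [hi]
  simp only [h, Finset.sum_add_distrib]
  congr 1
  · rw [← Finset.sum_filter]
    congr 1
    ext; simp
  · simp

/-- Double counting: a pair `i < j` contributes `D i j` to the degree in each of its two variables.
-/
lemma sum_mul_sum_Ioi {m : ℕ} (D : Fin m → Fin m → ℕ) (k : Fin m → ℕ) :
    ∑ i, (∑ j ∈ Finset.Iio i, D j i + ∑ j ∈ Finset.Ioi i, D i j) * k i
      = ∑ i, ∑ j ∈ Finset.Ioi i, D i j * (k i + k j) := by
  simp only [add_mul, mul_add, Finset.sum_add_distrib, Finset.sum_mul]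
  rw [add_comm]
  congr 1
  exact Finset.sum_comm' (by simp)

/-- The product of all one-variable and two-variable factors is a theta function of each variable. -/
lemma isThetaPoly_update {q p : ℂ} (hp : ‖p‖ < 1) (hq : q ≠ 0) {m : ℕ}
    {s : Fin m → ℕ} {b : ∀ i, Fin (s i) → ℂ} (v : ∀ i, Fin (s i) → ℕ) (hb : ∀ i j, b i j ≠ 0)
    (w r : Fin m → Fin m → ℕ) {α : ∀ i j, Fin (r i j) → ℂ} (u : ∀ i j, Fin (r i j) → ℕ)
    (hα : ∀ i j, i < j → ∀ l, α i j l ≠ 0) {y : Fin m → ℂ} (hy : ∀ i, y i ≠ 0) (i₀ : Fin m) :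
    IsThetaPoly p (∑ j, v i₀ j + (∑ j ∈ Finset.Iio i₀, (w j i₀ + 2 * ∑ l, u j i₀ l)
        + ∑ j ∈ Finset.Ioi i₀, (w i₀ j + 2 * ∑ l, u i₀ j l)))
      fun t => (∏ i, ∏ j, thetaFacs
          [b i j * Function.update y i₀ t i, b i j / Function.update y i₀ t i] q p (v i j)) *
        ∏ i, ∏ j ∈ Finset.Ioi i, pairFactor q p (w i j) (α i j) (u i j)
          (Function.update y i₀ t i) (Function.update y i₀ t j) := by
  -- The degree is spread over all factors, with degree zero for those not involving the variable
  -- `i₀`.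
  rw [← sum_sum_Ioi_ite i₀ fun i j => w i j + 2 * ∑ l, u i j l]
  refine IsThetaPoly.mul ?_ ?_
  · have : ∑ j, v i₀ j = ∑ i, if i = i₀ then ∑ j, v i j else 0 := by simp
    rw [this]
    refine IsThetaPoly.prod _ fun i _ => ?_
    split_ifs with h
    · subst h
      simp only [Function.update_self]
      refine IsThetaPoly.prod _ fun j _ => ?_
      simpa only [thetaFacs, List.map_cons, List.map_nil, List.prod_cons, List.prod_nil, mul_one]
        using isThetaPoly_thetaFac_pair hq (hb i j) (v i j)
    · simp only [Function.update_of_ne h]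
      exact IsThetaPoly.const _
  · refine IsThetaPoly.prod _ fun i _ => IsThetaPoly.prod _ fun j hj => ?_
    rw [Finset.mem_Ioi] at hj
    split_ifs with h h'
    · subst h
      simp only [Function.update_self, Function.update_of_ne hj.ne']
      exact isThetaPoly_pairFactor_left hp hq _ (hα i j hj) _ (hy j)
    · subst h'
      simp only [Function.update_self, Function.update_of_ne hj.ne]
      exact isThetaPoly_pairFactor_right hq _ (hα i j hj) _ (hy i)
    · simp only [Function.update_of_ne h, Function.update_of_ne h']
      exact IsThetaPoly.const _

/-! ### Evaluating the factors at the interpolation points. -/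

section

variable {q p : ℂ}

lemma thetaFacs_cons_ne_zero_iff {x : ℂ} {xs : List ℂ} {n : ℤ} :
    thetaFacs (x :: xs) q p n ≠ 0 ↔ thetaFac x q p n ≠ 0 ∧ thetaFacs xs q p n ≠ 0 := by
  simp [thetaFacs]

/-- Evaluation of a normalized one-variable factor at an interpolation point. -/
lemma thetaFacs_pair_shift (hp : ‖p‖ < 1) (hq : q ≠ 0) {a b : ℂ} (ha : a ≠ 0) (hb : b ≠ 0)
    {v n k : ℕ} (hk : k ≤ n) (h1 : thetaFacs [b * a, b / a] q p v ≠ 0)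
    (h2 : thetaFacs [a * b, a * q ^ (1 - (v : ℤ)) / b] q p n ≠ 0) :
    thetaFacs [b * (a * q ^ k), b / (a * q ^ k)] q p v / thetaFacs [b * a, b / a] q p v *
        q ^ (v * k)
      = thetaFacs [a * b * q ^ v, a * q / b] q p k /
        thetaFacs [a * b, a * q ^ (1 - (v : ℤ)) / b] q p k := by
  simp only [thetaFacs_cons_ne_zero_iff] at h1 h2
  have e1 : q ^ (1 - (v : ℤ)) / (b / a) = a * q ^ (1 - (v : ℤ)) / b := by field_simp
  have e2 : q / (b / a) = a * q / b := by field_simp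
  have e3 : b / a * q ^ (-(k : ℤ)) = b / (a * q ^ k) := by
    rw [zpow_neg, zpow_natCast]; field_simp
  have e4 : q ^ ((v : ℤ) * (k : ℤ)) = q ^ (v * k) := by rw [← zpow_natCast]; push_cast; rfl
  have h := thetaFac_pair_shift (x := b * a) hp hq (div_ne_zero hb ha) v k h1.1 h1.2.1
    (by rw [mul_comm]; exact thetaFac_natCast_ne_zero_of_le h2.1 hk)
    (by rw [e1]; exact thetaFac_natCast_ne_zero_of_le h2.2.1 hk) (fun h => by omega)
  rw [e1, e2, e3, e4, zpow_natCast, mul_assoc b, mul_comm b a] at h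
  simpa only [thetaFacs, List.map_cons, List.map_nil, List.prod_cons, List.prod_nil, mul_one,
    mul_comm b a] using h

/-- Evaluation of a normalized two-variable factor at a pair of interpolation points. -/
lemma thetaFacs_quadruple_shift (hp : ‖p‖ < 1) (hq : q ≠ 0) {a a' α : ℂ} (ha : a ≠ 0)
    (ha' : a' ≠ 0) (hα : α ≠ 0) {u n n' k k' : ℕ} (hk : k ≤ n) (hk' : k' ≤ n')
    (h_α : thetaFacs [α * a * a', α * a / a', α * a' / a, α / (a * a')] q p u ≠ 0)
    (h_add : thetaFacs [α * a * a', q ^ (1 - (u : ℤ)) * a * a' / α] q p ((n : ℤ) + n') ≠ 0)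
    (h_sub : thetaFacs [α * a / a', q ^ (1 - (u : ℤ)) * a / (a' * α)] q p n ≠ 0)
    (h_neg : thetaFacs [α * a / a', q ^ (1 - (u : ℤ)) * a / (a' * α), α * a * q ^ u / a',
      q * a / (a' * α)] q p (-(n' : ℤ)) ≠ 0) :
    thetaFacs [α * (a * q ^ k) * (a' * q ^ k'), α * (a * q ^ k) / (a' * q ^ k'),
          α * (a' * q ^ k') / (a * q ^ k), α / (a * q ^ k * (a' * q ^ k'))] q p u /
        thetaFacs [α * a * a', α * a / a', α * a' / a, α / (a * a')] q p u *
        q ^ (2 * u * (k + k'))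
      = q ^ (2 * u * k') * (thetaFacs [α * a * a' * q ^ u, q * a * a' / α] q p ((k : ℤ) + k') *
          thetaFacs [α * a * q ^ u / a', q * a / (a' * α)] q p ((k : ℤ) - k') /
        (thetaFacs [α * a * a', q ^ (1 - (u : ℤ)) * a * a' / α] q p ((k : ℤ) + k') *
          thetaFacs [α * a / a', q ^ (1 - (u : ℤ)) * a / (a' * α)] q p ((k : ℤ) - k'))) := by
  simp only [thetaFacs_cons_ne_zero_iff] at h_α h_add h_sub h_neg
  obtain ⟨α1, α2, α3, α4, -⟩ := h_α
  obtain ⟨s1, s2, -⟩ := h_sub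
  obtain ⟨g1, g2, g3, g4, -⟩ := h_neg
  have hlow : -(n' : ℤ) ≤ (k : ℤ) - k' := by omega
  have hup : (k : ℤ) - k' ≤ n := by omega
  have hnn : (k : ℤ) + k' = ((k + k' : ℕ) : ℤ) := by push_cast; rfl
  have hle : k + k' ≤ n + n' := by omega
  have hadd : ∀ {x : ℂ}, thetaFac x q p ((n : ℤ) + n') ≠ 0 → thetaFac x q p ((k : ℤ) + k') ≠ 0 :=
    fun {x} h => by
      rw [hnn]
      exact thetaFac_natCast_ne_zero_of_le (n := n + n') (by push_cast; exact h) hle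
  have hneg : ∀ {x : ℂ}, thetaFac x q p (-(n' : ℤ)) ≠ 0 → (k : ℤ) - k' < 0 →
      thetaFac x q p ((k : ℤ) - k') ≠ 0 := fun {x} h hK =>
    thetaFac_ne_zero_of_mem_Icc (n := 0) hq
      (by simp only [thetaFac_natCast, thetaFacNat]; simp) h hlow (by simpa using hK.le)
  have e1 : q ^ (1 - (u : ℤ)) / (α / (a * a')) = q ^ (1 - (u : ℤ)) * a * a' / α := by field_simp
  have e2 : q / (α / (a * a')) = q * a * a' / α := by field_simp
  have e3 : q ^ (1 - (u : ℤ)) / (α * a' / a) = q ^ (1 - (u : ℤ)) * a / (a' * α) := by field_simp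
  have e4 : q / (α * a' / a) = q * a / (a' * α) := by field_simp
  -- The four factorials form two pairs: `αaa'` and `α/(aa')` move by `k + k'` in opposite
  -- directions, `αa/a'` and `αa'/a` by `k - k'`.
  have A := thetaFac_pair_shift (x := α * a * a') hp hq (div_ne_zero hα (mul_ne_zero ha ha')) u
    ((k : ℤ) + k') α1 α4 (hadd h_add.1) (by rw [e1]; exact hadd h_add.2.1) (fun h => by omega)
  have B := thetaFac_pair_shift (x := α * a / a') hp hq (div_ne_zero (mul_ne_zero hα ha') ha) u
    ((k : ℤ) - k') α2 α3 (thetaFac_ne_zero_of_mem_Icc hq s1 g1 hlow hup)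
    (by rw [e3]; exact thetaFac_ne_zero_of_mem_Icc hq s2 g2 hlow hup)
    (fun h => ⟨by rw [div_mul_eq_mul_div]; exact hneg g3 h, by rw [e4]; exact hneg g4 h⟩)
  have f1 : α * (a * q ^ k) * (a' * q ^ k') = α * a * a' * q ^ ((k : ℤ) + k') := by
    rw [zpow_add₀ hq, zpow_natCast, zpow_natCast]; ring
  have f2 : α * (a * q ^ k) / (a' * q ^ k') = α * a / a' * q ^ ((k : ℤ) - k') := by
    rw [zpow_sub₀ hq, zpow_natCast, zpow_natCast]; field_simp
  have f3 : α * (a' * q ^ k') / (a * q ^ k) = α * a' / a * q ^ (-((k : ℤ) - k')) := by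
    rw [neg_sub, zpow_sub₀ hq, zpow_natCast, zpow_natCast]; field_simp
  have f4 : α / (a * q ^ k * (a' * q ^ k')) = α / (a * a') * q ^ (-((k : ℤ) + k')) := by
    rw [zpow_neg, zpow_add₀ hq, zpow_natCast, zpow_natCast]; field_simp
  have f5 : α * a * q ^ u / a' = α * a / a' * q ^ u := by ring
  -- The two pair shifts absorb `u(k+k') + u(k-k') = 2uk`; the remaining `2uk'` is the asymmetric
  -- power of `q` in the summand.
  have f6 : q ^ (2 * u * (k + k'))
      = q ^ (2 * u * k') * q ^ ((u : ℤ) * (k + k')) * q ^ ((u : ℤ) * (k - k')) := by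
    rw [← zpow_natCast, ← zpow_natCast, ← zpow_add₀ hq, ← zpow_add₀ hq]
    congr 1; push_cast; ring
  simp only [thetaFacs, List.map_cons, List.map_nil, List.prod_cons, List.prod_nil, mul_one]
  rw [f1, f2, f3, f4, f5, f6]
  rw [e1, e2] at A
  rw [e3, e4] at B
  rw [mul_div_mul_comm (_ * _) (_ * _) (_ * _) (_ * _), ← A, ← B]
  field_simp

lemma pairFactor_shift (hp : ‖p‖ < 1) (hq : q ≠ 0) {a a' : ℂ} (ha : a ≠ 0) (ha' : a' ≠ 0)
    (w : ℕ) {r : ℕ} {α : Fin r → ℂ} (hα : ∀ l, α l ≠ 0) {u : Fin r → ℕ} {n n' k k' : ℕ}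
    (hk : k ≤ n) (hk' : k' ≤ n')
    (h_α : ∀ l, thetaFacs
      [α l * a * a', α l * a / a', α l * a' / a, α l / (a * a')] q p (u l) ≠ 0)
    (h_add : ∀ l, thetaFacs
      [α l * a * a', q ^ (1 - (u l : ℤ)) * a * a' / α l] q p ((n : ℤ) + n') ≠ 0)
    (h_sub : ∀ l, thetaFacs
      [α l * a / a', q ^ (1 - (u l : ℤ)) * a / (a' * α l)] q p n ≠ 0)
    (h_neg : ∀ l, thetaFacs [α l * a / a', q ^ (1 - (u l : ℤ)) * a / (a' * α l),
      α l * a * q ^ (u l) / a', q * a / (a' * α l)] q p (-(n' : ℤ)) ≠ 0) :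
    a ^ w * (∏ l, thetaFacs
        [α l * a * a', α l * a / a', α l * a' / a, α l / (a * a')] q p (u l))⁻¹ *
      pairFactor q p w α u (a * q ^ k) (a' * q ^ k') * q ^ ((w + 2 * ∑ l, u l) * (k + k'))
      = (∏ l, (q ^ (2 * u l * k') *
          (thetaFacs [α l * a * a' * q ^ u l, q * a * a' / α l] q p ((k : ℤ) + k') *
            thetaFacs [α l * a * q ^ u l / a', q * a / (a' * α l)] q p ((k : ℤ) - k') /
          (thetaFacs [α l * a * a', q ^ (1 - (u l : ℤ)) * a * a' / α l] q p ((k : ℤ) + k') *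
            thetaFacs [α l * a / a', q ^ (1 - (u l : ℤ)) * a / (a' * α l)] q p
              ((k : ℤ) - k'))))) *
        (q ^ (w * k') *
          thetas [a * a' * q ^ (k + k'), a * q ^ ((k : ℤ) - k') / a'] p ^ w) := by
  rw [← Finset.prod_congr rfl fun l _ => thetaFacs_quadruple_shift hp hq ha ha' (hα l) hk hk'
    (h_α l) (h_add l) (h_sub l) (h_neg l)]
  rw [pairFactor, Finset.prod_mul_distrib, Finset.prod_div_distrib, Finset.prod_pow_eq_pow_sum]
  have e1 : a * q ^ k * (a' * q ^ k') = a * a' * q ^ (k + k') := by ring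
  have e2 : a * q ^ k / (a' * q ^ k') = a * q ^ ((k : ℤ) - k') / a' := by
    rw [zpow_sub₀ hq, zpow_natCast, zpow_natCast]; field_simp
  have e3 : a ^ w * (a * q ^ k) ^ (-(w : ℤ)) * q ^ (w * (k + k')) = q ^ (w * k') := by
    rw [zpow_neg, zpow_natCast, mul_pow, ← pow_mul, mul_add, pow_add, mul_comm k w]
    field_simp
  have e4 : q ^ ((w + 2 * ∑ l, u l) * (k + k'))
      = q ^ (w * (k + k')) * q ^ (∑ l, 2 * u l * (k + k')) := by
    rw [← Finset.sum_mul, ← Finset.mul_sum, add_mul, pow_add]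
  rw [e4, ← e3, thetas, thetas]
  simp only [List.map_cons, List.map_nil, List.prod_cons, List.prod_nil, mul_one, e1, e2]
  ring

end

/-! ### Assembling the multiple sum. -/

/-- Bookkeeping for one summand: the surplus powers `Q` of the kernels are redistributed as `V` to
the one-variable factors and as `R` to the pairs. -/
lemma prod_regroup {m : ℕ} {β T T' S S' Q V : Fin m → ℂ} {C P U W R : Fin m → Fin m → ℂ}
    (hT : ∀ i, T' i = Q i * T i) (hS : ∀ i, β i * S' i * V i = S i)
    (hP : ∀ i, ∀ j ∈ Finset.Ioi i, C i j * P i j * R i j = U i j * W i j)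
    (hQ : ∏ i, Q i = (∏ i, V i) * ∏ i, ∏ j ∈ Finset.Ioi i, R i j) :
    (∏ i, β i) * (∏ i, ∏ j ∈ Finset.Ioi i, C i j) *
        ((∏ i, T' i) * ((∏ i, S' i) * ∏ i, ∏ j ∈ Finset.Ioi i, P i j))
      = (∏ i, (T i * S i)) * (∏ i, ∏ j ∈ Finset.Ioi i, U i j) *
        ∏ i, ∏ j ∈ Finset.Ioi i, W i j := by
  have hUW : (∏ i, ∏ j ∈ Finset.Ioi i, U i j) * ∏ i, ∏ j ∈ Finset.Ioi i, W i j
      = ∏ i, ∏ j ∈ Finset.Ioi i, (C i j * P i j * R i j) := by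
    simp only [← Finset.prod_mul_distrib]
    exact Finset.prod_congr rfl fun i _ => Finset.prod_congr rfl fun j hj => (hP i j hj).symm
  rw [mul_assoc (∏ i, (T i * S i)), hUW]
  simp only [hT, ← hS, Finset.prod_mul_distrib, hQ]
  ring

end EllipticKM

theorem corollary2p11
    (q p : ℂ) (hq : q ≠ 0) (hp : ‖p‖ < 1)
    (m : ℕ) (a z : Fin m → ℂ) (ha : ∀ i, a i ≠ 0) (hz : ∀ i, z i ≠ 0)
    -- the data `b_{ij}`, `v_{ij}`, for `1 ≤ j ≤ s_i`
    (s : Fin m → ℕ) (b : ∀ i, Fin (s i) → ℂ) (v : ∀ i, Fin (s i) → ℕ)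
    (hb : ∀ i j, b i j ≠ 0)
    -- the data `w_{ij}`, `α_{l_{ij}}`, `u_{l_{ij}}`, for `1 ≤ l_{ij} ≤ r_{ij}`
    -- (only the values with `i < j` are used)
    (w r : Fin m → Fin m → ℕ)
    (α : ∀ i j, Fin (r i j) → ℂ) (u : ∀ i j, Fin (r i j) → ℕ)
    (hα : ∀ i j, i < j → ∀ l, α i j l ≠ 0)
    (n : Fin m → ℕ)
    (hn : ∀ i, n i =
      ∑ j, v i j + ∑ j ∈ Finset.Iio i, w j i + ∑ j ∈ Finset.Ioi i, w i j
        + 2 * ∑ j ∈ Finset.Iio i, ∑ l, u j i l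
        + 2 * ∑ j ∈ Finset.Ioi i, ∑ l, u i j l)
    -- no denominator on either side vanishes
    (h_vwp : ∀ i, EllipticKM.theta (a i ^ 2) p ≠ 0)
    (h_z : ∀ i, EllipticKM.thetaFacs
      [q, a i ^ 2 * q ^ (n i + 1), a i * q * z i, a i * q / z i] q p (n i) ≠ 0)
    (h_b : ∀ i j, EllipticKM.thetaFacs [b i j * a i, b i j / a i] q p (v i j) ≠ 0)
    (h_b' : ∀ i j, EllipticKM.thetaFacs
      [a i * b i j, a i * q ^ (1 - (v i j : ℤ)) / b i j] q p (n i) ≠ 0)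
    (h_α : ∀ i j, i < j → ∀ l, EllipticKM.thetaFacs
      [α i j l * a i * a j, α i j l * a i / a j,
        α i j l * a j / a i, α i j l / (a i * a j)] q p (u i j l) ≠ 0)
    (h_add : ∀ i j, i < j → ∀ l, EllipticKM.thetaFacs
      [α i j l * a i * a j, q ^ (1 - (u i j l : ℤ)) * a i * a j / α i j l] q p
      ((n i : ℤ) + n j) ≠ 0)
    (h_sub : ∀ i j, i < j → ∀ l, EllipticKM.thetaFacs
      [α i j l * a i / a j, q ^ (1 - (u i j l : ℤ)) * a i / (a j * α i j l)] q p
      (n i) ≠ 0)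
    -- the theta shifted factorials of negative index `k_i - k_j` are defined
    (h_neg : ∀ i j, i < j → ∀ l, EllipticKM.thetaFacs
      [α i j l * a i / a j, q ^ (1 - (u i j l : ℤ)) * a i / (a j * α i j l),
        α i j l * a i * q ^ (u i j l) / a j, q * a i / (a j * α i j l)] q p
      (-(n j : ℤ)) ≠ 0) :
    (∏ i,
        (EllipticKM.thetaFacs [a i ^ 2 * q, q] q p (n i)
            / EllipticKM.thetaFacs [a i * q * z i, a i * q / z i] q p (n i)
          * ∏ j, (EllipticKM.thetaFacs [b i j * z i, b i j / z i] q p (v i j)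
              / EllipticKM.thetaFacs [b i j * a i, b i j / a i] q p (v i j))))
      * (∏ i, ∏ j ∈ Finset.Ioi i,
          (a i ^ w i j * z i ^ (-(w i j : ℤ))
            * EllipticKM.thetas [z i * z j, z i / z j] p ^ w i j
            * ∏ l,
              (EllipticKM.thetaFacs
                  [α i j l * z i * z j, α i j l * z i / z j,
                    α i j l * z j / z i, α i j l / (z i * z j)] q p (u i j l)
                / EllipticKM.thetaFacs
                  [α i j l * a i * a j, α i j l * a i / a j,
                    α i j l * a j / a i, α i j l / (a i * a j)] q p (u i j l))))
    = ∑ k ∈ Fintype.piFinset fun i => Finset.range (n i + 1),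
        (∏ i,
          (q ^ k i
            * (EllipticKM.theta (a i ^ 2 * q ^ (2 * k i)) p
                / EllipticKM.theta (a i ^ 2) p)
            * (EllipticKM.thetaFacs
                  [q ^ (-(n i : ℤ)), a i ^ 2, a i * z i, a i / z i] q p (k i)
                / EllipticKM.thetaFacs
                  [q, a i ^ 2 * q ^ (n i + 1), a i * q * z i, a i * q / z i] q p (k i))
            * ∏ j,
              (EllipticKM.thetaFacs
                  [a i * b i j * q ^ v i j, a i * q / b i j] q p (k i)
                / EllipticKM.thetaFacs
                  [a i * b i j, a i * q ^ (1 - (v i j : ℤ)) / b i j] q p (k i))))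
        * (∏ i, ∏ j ∈ Finset.Ioi i, ∏ l,
            (q ^ (2 * u i j l * k j)
              * (EllipticKM.thetaFacs
                    [α i j l * a i * a j * q ^ u i j l, q * a i * a j / α i j l] q p
                    ((k i : ℤ) + k j)
                  * EllipticKM.thetaFacs
                    [α i j l * a i * q ^ u i j l / a j, q * a i / (a j * α i j l)] q p
                    ((k i : ℤ) - k j)
                / (EllipticKM.thetaFacs
                    [α i j l * a i * a j,
                      q ^ (1 - (u i j l : ℤ)) * a i * a j / α i j l] q p
                    ((k i : ℤ) + k j)
                  * EllipticKM.thetaFacs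
                    [α i j l * a i / a j,
                      q ^ (1 - (u i j l : ℤ)) * a i / (a j * α i j l)] q p
                    ((k i : ℤ) - k j)))))
        * (∏ i, ∏ j ∈ Finset.Ioi i,
            (q ^ (w i j * k j)
              * EllipticKM.thetas
                  [a i * a j * q ^ (k i + k j),
                    a i * q ^ ((k i : ℤ) - k j) / a j] p ^ w i j)) := by 
  have hα' : ∀ i, ∀ j ∈ Finset.Ioi i, ∀ l, α i j l ≠ 0 := fun i j hj =>
    hα i j (Finset.mem_Ioi.1 hj)
  set D : Fin m → Fin m → ℕ := fun i j => w i j + 2 * ∑ l, u i j l with hD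
  have hn' : ∀ i, n i = ∑ j, v i j + (∑ j ∈ Finset.Iio i, D j i + ∑ j ∈ Finset.Ioi i, D i j) := by
    intro i
    rw [hn i]
    simp only [hD, Finset.sum_add_distrib, ← Finset.mul_sum]
    ring
  set A : Fin m → ℂ := fun i =>
    EllipticKM.thetaFacNat q p (a i ^ 2 * q) (n i) * EllipticKM.thetaFacNat q p q (n i) /
      (EllipticKM.thetaFacNat q p (a i * q * z i) (n i) *
        EllipticKM.thetaFacNat q p (a i * q / z i) (n i)) with hA
  set B : Fin m → ℂ := fun i =>
    ∏ j, EllipticKM.thetaFacs [b i j * a i, b i j / a i] q p (v i j) with hB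
  set E : Fin m → Fin m → ℂ := fun i j => ∏ l, EllipticKM.thetaFacs
    [α i j l * a i * a j, α i j l * a i / a j,
      α i j l * a j / a i, α i j l / (a i * a j)] q p (u i j l) with hE
  set F : (Fin m → ℂ) → ℂ := fun y =>
    (∏ i, ∏ j, EllipticKM.thetaFacs [b i j * y i, b i j / y i] q p (v i j)) *
      ∏ i, ∏ j ∈ Finset.Ioi i,
        EllipticKM.pairFactor q p (w i j) (α i j) (u i j) (y i) (y j) with hF
  -- By `hn'`, `n i` is exactly the degree of `F` in its `i`-th variable, so `n i + 1` nodes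
  -- suffice.
  have main := EllipticKM.prod_mul_eq_sum_piFinset n A
    (fun i k => EllipticKM.kernel q p (a i) (z i) (n i) k) (fun i k => a i * q ^ k) z F hz
    (fun i k => mul_ne_zero (ha i) (pow_ne_zero k hq)) (fun i y hy => by
      have hf := EllipticKM.isThetaPoly_update hp hq v hb w r u hα hy i
      rw [← hn' i] at hf
      have h := h_z i
      simp only [EllipticKM.thetaFacs_cons_ne_zero_iff] at h
      exact hf.mul_eq_sum_kernel hp hq (ha i) (hz i) (h_vwp i) h.1 h.2.1 h.2.2.1 h.2.2.2.1)
  -- The denominators `B`, `E` and the powers of `a i` are constant in `z` and in `k`, so they can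
  -- be restored after interpolation.
  have hleft : (∏ i, (B i)⁻¹) * (∏ i, ∏ j ∈ Finset.Ioi i, a i ^ w i j * (E i j)⁻¹) *
      ((∏ i, A i) * F z) = (∏ i,
        (EllipticKM.thetaFacs [a i ^ 2 * q, q] q p (n i)
            / EllipticKM.thetaFacs [a i * q * z i, a i * q / z i] q p (n i)
          * ∏ j, (EllipticKM.thetaFacs [b i j * z i, b i j / z i] q p (v i j)
              / EllipticKM.thetaFacs [b i j * a i, b i j / a i] q p (v i j))))
      * (∏ i, ∏ j ∈ Finset.Ioi i,
          (a i ^ w i j * z i ^ (-(w i j : ℤ))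
            * EllipticKM.thetas [z i * z j, z i / z j] p ^ w i j
            * ∏ l,
              (EllipticKM.thetaFacs
                  [α i j l * z i * z j, α i j l * z i / z j,
                    α i j l * z j / z i, α i j l / (z i * z j)] q p (u i j l)
                / EllipticKM.thetaFacs
                  [α i j l * a i * a j, α i j l * a i / a j,
                    α i j l * a j / a i, α i j l / (a i * a j)] q p (u i j l)))) := by
    have hA' : ∀ i, A i = EllipticKM.thetaFacs [a i ^ 2 * q, q] q p (n i)
            / EllipticKM.thetaFacs [a i * q * z i, a i * q / z i] q p (n i) := fun i => by
      simp [hA, EllipticKM.thetaFacs, EllipticKM.thetaFac_natCast]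
    simp only [hF, ← hA', Finset.prod_div_distrib, EllipticKM.pairFactor,
      Finset.prod_mul_distrib, Finset.prod_inv_distrib, hB, hE]
    simp only [div_eq_mul_inv]
    ring
  rw [← hleft, main, Finset.mul_sum]
  refine Finset.sum_congr rfl fun k hk => ?_
  have hk' : ∀ i, k i ≤ n i := fun i => by
    have := Fintype.mem_piFinset.1 hk i
    rw [Finset.mem_range] at this
    omega
  have hb_shift := fun i j => EllipticKM.thetaFacs_pair_shift hp hq (ha i) (hb i j) (hk' i)
    (h_b i j) (h_b' i j)
  have hp_shift := fun i j (hj : j ∈ Finset.Ioi i) =>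
    EllipticKM.pairFactor_shift hp hq (ha i) (ha j) (w i j) (hα' i j hj) (hk' i) (hk' j)
      (h_α i j (Finset.mem_Ioi.1 hj)) (h_add i j (Finset.mem_Ioi.1 hj))
      (h_sub i j (Finset.mem_Ioi.1 hj)) (h_neg i j (Finset.mem_Ioi.1 hj))
  -- Each kernel carries `q^{(n_i+1)k_i}`, the target only `q^{k_i}`; the excess is what the shift
  -- lemmas consume.
  have hpow : ∏ i, q ^ (n i * k i)
      = (∏ i, ∏ j, q ^ (v i j * k i)) * ∏ i, ∏ j ∈ Finset.Ioi i, q ^ (D i j * (k i + k j)) := by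
    simp only [Finset.prod_pow_eq_pow_sum, ← pow_add]
    congr 1
    rw [← EllipticKM.sum_mul_sum_Ioi, ← Finset.sum_add_distrib]
    refine Finset.sum_congr rfl fun i _ => ?_
    rw [hn' i, ← Finset.sum_mul, ← add_mul]
  have hker : ∀ i, EllipticKM.kernel q p (a i) (z i) (n i) (k i) = q ^ (n i * k i) * (q ^ k i
      * (EllipticKM.theta (a i ^ 2 * q ^ (2 * k i)) p / EllipticKM.theta (a i ^ 2) p)
      * (EllipticKM.thetaFacs [q ^ (-(n i : ℤ)), a i ^ 2, a i * z i, a i / z i] q p (k i)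
          / EllipticKM.thetaFacs
            [q, a i ^ 2 * q ^ (n i + 1), a i * q * z i, a i * q / z i] q p (k i))) := fun i => by
    simp only [EllipticKM.kernel, EllipticKM.thetaFacs, EllipticKM.thetaFac_natCast, List.map_cons,
      List.map_nil, List.prod_cons, List.prod_nil, mul_one, add_mul, pow_add, one_mul, mul_assoc]
  refine EllipticKM.prod_regroup hker (fun i => ?_) hp_shift hpow
  rw [← Finset.prod_congr rfl fun j _ => hb_shift i j, Finset.prod_mul_distrib,
    Finset.prod_div_distrib, div_eq_inv_mul]
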